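/- Let $k$ be a field and let $\mathcal H$ be a $k$-linear hereditary abelian category that is Hom-finite and Ext-finite, i.e. $\operatorname{Hom}_{\mathcal H}(X,Y)$ and $\operatorname{Ext}^1_{\mathcal H}(X,Y)$ are finite-dimensional over $k$ and $\operatorname{Ext}^2_{\mathcal H}(X,Y)=0$ for all $X,Y\in\mathcal H$. Let $D$ be a presilting object of the bounded derived category $\mathcal D^b(\mathcal H)$, i.e. $\operatorname{Hom}_{\mathcal D^b(\mathcal H)}(D,D[n])=0$ for all $n>0$. Let $$D^{\perp_{\mathbb Z}}=\{M\in\mathcal H \mid \operatorname{Hom}_{\mathcal D^b(\mathcal H)}(D,M[n])=0 \text{ for all } n\in\mathbb Z\},$$ regarded as a full subcategory of $\mathcal H$, and let $\operatorname{thick} D$ be the smallest triangulated subcategory of $\mathcal D^b(\mathcal H)$ that is closed under direct summands and contains $D$. Then $D^{\perp_{\mathbb Z}}$ contains $0$ and is closed under finite direct sums, kernels and cokernels in $\mathcal H$, hence is an abelian category; it is again a Hom-finite and Ext-finite $k$-linear hereditary abelian category; and there is a $k$-linear triangle equivalence $$\mathcal D^b(D^{\perp_{\mathbb Z}})\;\simeq\;\mathcal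 D^b(\mathcal H)/\operatorname{thick} D,$$ where the right-hand side is the Verdier quotient. -/

import Mathlib

open CategoryTheory Limits Pretriangulated Triangulated

universe t w w' v u

/-- A Hom-finite and Ext-finite `k`-linear hereditary abelian category: `Hom(X, Y)` and
`Ext¹(X, Y)` are finite-dimensional and `Ext²(X, Y) = 0` for all objects `X` and `Y`. -/
structure IsHereditaryAbelian (k : Type t) [Field k] (A : Type u) [Category.{v} A] [Abelian A]
    [Linear k A] : Prop where
  hom_finite (X Y : A) : Module.Finite k (X ⟶ Y)
  ext_finite (X Y : A) :
    haveI := HasExt.standard A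
    Module.Finite k (Abelian.Ext.{max u v} X Y 1)
  ext_two (X Y : A) :
    haveI := HasExt.standard A
    Subsingleton (Abelian.Ext.{max u v} X Y 2)

/-- The object `M` of `H`, seen in the bounded derived category as a complex
concentrated in degree `0`. -/
noncomputable def boundedStalk {H : Type u} [Category.{v} H] [Abelian H]
    [HasDerivedCategory.{w} H] (M : H) : DerivedCategory.Bounded H :=
  ⟨(DerivedCategory.singleFunctor H 0).obj M,
    ⟨⟨0, inferInstance⟩, ⟨0, inferInstance⟩⟩⟩

/-- `T` is presilting if `Hom(T, T[n]) = 0` for all `n > 0`. -/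
def IsPresilting {C : Type u} [Category.{v} C] [Preadditive C] [HasShift C ℤ] (T : C) : Prop :=
  ∀ n : ℤ, 0 < n → ∀ f : T ⟶ T⟦n⟧, f = 0

/-- The perpendicular category of `D`: the full subcategory of `H` on the objects `M` such that
`Hom(D, M[n]) = 0` in the bounded derived category, for all integers `n`. -/
def perpZ {H : Type u} [Category.{v} H] [Abelian H] [HasDerivedCategory.{w} H]
    (D : DerivedCategory.Bounded H) : ObjectProperty H :=
  fun M => ∀ n : ℤ, ∀ f : D ⟶ (boundedStalk M)⟦n⟧, f = 0

/-- The smallest thick subcategory containing `X`, that is, the smallest triangulated subcategory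
which is closed under direct summands and contains `X`. -/
abbrev thick {C : Type u} [Category.{v} C] [HasZeroObject C] [HasShift C ℤ] [Preadditive C]
    [∀ n : ℤ, (shiftFunctor C n).Additive] [Pretriangulated C] (X : C) : ObjectProperty C :=
  (ObjectProperty.singleton X).triangEnvelope

/-- The Verdier quotient of `C` by the thick subcategory generated by `X`: the localization of `C`
at the morphisms whose cone lies in `thick X`. -/
abbrev VerdierQuotient {C : Type u} [Category.{v} C] [HasZeroObject C] [HasShift C ℤ]
    [Preadditive C] [∀ n : ℤ, (shiftFunctor C n).Additive] [Pretriangulated C] (X : C) :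
    Type u :=
  (thick X).trW.Localization

/-! In a hereditary category every bounded complex is a finite sum of shifted stalks, so most
questions about `D` reduce to stalks and to Ext in degrees 0 and 1.

The central fact is that `thick D` is right admissible: each object is an extension of an object of
the right orthogonal by one of `thick D`. For a rigid stalk (`prop_stalk_of_rigid`) this comes from
a universal extension and two approximations by sums of copies of it. In general the summands of `D`
are glued in order of degree (`IsRightAdmissible.biprod`): the presilting condition kills positive
Homs between them, the degrees kill the others.

The right orthogonal is closed under summands, hence built from the stalks it contains, which are
those of `perpZ D`. That subcategory is exact and extension closed in `H`, so its inclusion is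
bijective on Hom and Ext¹ and both sides have Ext² = 0; the induced functor on bounded derived
categories is therefore fully faithful, with values in the right orthogonal. On morphisms into that
orthogonal the Verdier quotient functor is bijective, so the composite is fully faithful.
Admissibility makes it essentially surjective. -/

namespace CategoryTheory.ObjectProperty

/-! ### Orthogonals and extension products -/

section

variable {C : Type u} [Category.{v} C] [HasZeroMorphisms C] (P : ObjectProperty C)

instance isStableUnderRetracts_rightOrthogonal : P.rightOrthogonal.IsStableUnderRetracts where
  of_retract r h X f hX := by
    rw [← Category.comp_id f, ← r.retract, ← Category.assoc, h (f ≫ r.i) hX, zero_comp]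

instance isStableUnderRetracts_leftOrthogonal : P.leftOrthogonal.IsStableUnderRetracts where
  of_retract r h X f hX := by
    rw [← Category.id_comp f, ← r.retract, Category.assoc, h (r.r ≫ f) hX, comp_zero]

end

variable {C : Type u} [Category.{v} C] [HasZeroObject C] [HasShift C ℤ] [Preadditive C]
  [∀ n : ℤ, (shiftFunctor C n).Additive] [Pretriangulated C]

lemma prop_biprod_of_isTriangulated (P : ObjectProperty C) [P.IsTriangulated]
    [P.IsClosedUnderIsomorphisms] {X Y : C} (hX : P X) (hY : P Y) : P (X ⊞ Y) :=
  P.ext_of_isTriangulatedClosed₂ _ (binaryBiproductTriangle_distinguished X Y) hX hY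

/-- The connecting morphism goes from `P` to a shift of `Q`, so it vanishes; the triangle splits and
the two summands can be exchanged. -/
lemma extensionProduct_swap_le (P Q : ObjectProperty C) [Q.IsStableUnderShift ℤ]
    (h : P ≤ Q.leftOrthogonal) : extensionProduct Q P ≤ extensionProduct P Q := by
  rintro X ⟨Y, Z, f, g, δ, hT, hY, hZ⟩
  obtain ⟨e, -, -⟩ := exists_iso_binaryBiproduct_of_distTriang _ hT
    (h Z hZ δ (Q.le_shift _ _ hY))
  refine (extensionProduct P Q).prop_of_iso (biprod.braiding Z Y ≪≫ e.symm) ?_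
  exact ⟨_, _, _, _, _, binaryBiproductTriangle_distinguished Z Y, hZ, hY⟩

/-- Associativity and the swap give (P*Q)*(P*Q) = P*(Q*P)*Q ≤ P*(P*Q)*Q = (P*P)*(Q*Q) ≤ P*Q. -/
lemma isTriangulated_extensionProduct [IsTriangulated C] (P Q : ObjectProperty C)
    [P.IsTriangulated] [Q.IsTriangulated] [P.IsClosedUnderIsomorphisms]
    [Q.IsClosedUnderIsomorphisms] (h : P ≤ Q.leftOrthogonal) :
    (extensionProduct P Q).IsTriangulated where
  exists_zero := by
    obtain ⟨Z, hZ, hP⟩ := P.exists_prop_of_containsZero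
    exact ⟨Z, hZ, le_extensionProduct_left _ _ hP⟩
  toIsTriangulatedClosed₂ := by
    refine .mk' (fun T hT h₁ h₃ => ?_)
    have hX : extensionProduct (extensionProduct P Q) (extensionProduct P Q) T.obj₂ :=
      ⟨_, _, _, _, _, hT, h₁, h₃⟩
    have hPP : extensionProduct P P ≤ P :=
      extensionProduct_le_of_isTriangulatedClosed₂ le_rfl le_rfl
    have hQQ : extensionProduct Q Q ≤ Q :=
      extensionProduct_le_of_isTriangulatedClosed₂ le_rfl le_rfl
    rw [extensionProduct_assoc, ← extensionProduct_assoc Q P Q] at hX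
    have h' := monotone_extensionProduct_right P
      (monotone_extensionProduct_left Q (extensionProduct_swap_le P Q h)) _ hX
    rw [extensionProduct_assoc, ← extensionProduct_assoc P P] at h'
    exact monotone_extensionProduct_left _ hPP _ (monotone_extensionProduct_right _ hQQ _ h')

end CategoryTheory.ObjectProperty

/-! ### Thick subcategories and right admissibility -/

section Thick

variable {C : Type u} [Category.{v} C] [HasZeroObject C] [HasShift C ℤ] [Preadditive C]
  [∀ n : ℤ, (shiftFunctor C n).Additive] [Pretriangulated C]

lemma thick_le_iff {P : ObjectProperty C} [P.IsStableUnderRetracts] [P.IsTriangulated] {X : C} :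
    thick X ≤ P ↔ P X := by
  rw [ObjectProperty.triangEnvelope_le_iff]
  simp

/-- The right orthogonal of `thick X`, that is, the objects `Y` such that
`Hom(X, Y[n]) = 0` for all `n`. -/
abbrev thickPerp (X : C) : ObjectProperty C := (thick X).rightOrthogonal

lemma thickPerp_shift_iff {X Y : C} (n : ℤ) : thickPerp X (Y⟦n⟧) ↔ thickPerp X Y :=
  (thickPerp X).prop_shift_iff_of_isStableUnderShift Y n

lemma le_thickPerp_leftOrthogonal (X : C) : thick X ≤ (thickPerp X).leftOrthogonal :=
  fun _ hZ _ f hY => hY f hZ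

/-- `thick X` is right admissible: every object is an extension of an object of the right orthogonal
of `thick X` by an object of `thick X`. -/
def IsRightAdmissible (X : C) : Prop :=
  ObjectProperty.extensionProduct (thick X) (thickPerp X) = ⊤

lemma IsRightAdmissible.of_thick_eq {X Y : C} (h : thick X = thick Y)
    (hX : IsRightAdmissible X) : IsRightAdmissible Y := by
  unfold IsRightAdmissible thickPerp at *
  rwa [h] at hX

variable [IsTriangulated C]

lemma thick_self (X : C) : thick X X := thick_le_iff.1 le_rfl

lemma thickPerp_iff {X Y : C} : thickPerp X Y ↔ ∀ (n : ℤ) (f : X ⟶ Y⟦n⟧), f = 0 := by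
  constructor
  · intro h n f
    exact (thickPerp X).le_shift n _ h f (thick_self X)
  · intro h Z f hZ
    -- The left orthogonal of a shift-stable class is thick, so it is enough that it contains `X`.
    let S := (ObjectProperty.singleton Y).shiftClosure ℤ
    have hS : thick X ≤ S.leftOrthogonal := by
      rw [thick_le_iff]
      rintro W g ⟨Y', n, e, hY'⟩
      obtain rfl : Y = Y' := by simpa using hY'
      rw [← cancel_mono e.hom, h n (g ≫ e.hom), zero_comp]
    exact hS Z hZ f ((ObjectProperty.singleton Y).le_shiftClosure _ (by simp))

lemma thick_shift (X : C) (n : ℤ) : thick (X⟦n⟧) = thick X := by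
  refine le_antisymm (thick_le_iff.2 ((thick X).le_shift n _ (thick_self X))) (thick_le_iff.2 ?_)
  exact ((thick (X⟦n⟧)).prop_shift_iff_of_isStableUnderShift X n).1 (thick_self _)

lemma thick_congr {X Y : C} (e : X ≅ Y) : thick X = thick Y :=
  le_antisymm (thick_le_iff.2 ((thick Y).prop_of_iso e.symm (thick_self Y)))
    (thick_le_iff.2 ((thick X).prop_of_iso e (thick_self X)))

lemma thick_le_thick_biprod_left (X Y : C) : thick X ≤ thick (X ⊞ Y) :=
  thick_le_iff.2 (ObjectProperty.IsStableUnderRetracts.of_biprod_left _ (thick_self (X ⊞ Y)))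

lemma thick_le_thick_biprod_right (X Y : C) : thick Y ≤ thick (X ⊞ Y) :=
  thick_le_iff.2 (ObjectProperty.IsStableUnderRetracts.of_biprod_right _ (thick_self (X ⊞ Y)))

lemma thickPerp_biprod_iff {X X' Y : C} :
    thickPerp (X ⊞ X') Y ↔ thickPerp X Y ∧ thickPerp X' Y := by
  constructor
  · intro h
    exact ⟨fun Z f hZ => h f (thick_le_thick_biprod_left _ _ _ hZ),
      fun Z f hZ => h f (thick_le_thick_biprod_right _ _ _ hZ)⟩
  · rintro ⟨h, h'⟩
    rw [thickPerp_iff] at h h' ⊢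
    intro n f
    ext
    · simpa using h n _
    · simpa using h' n _

lemma isTriangulated_extensionProduct_thick (X : C) :
    (ObjectProperty.extensionProduct (thick X) (thickPerp X)).IsTriangulated :=
  ObjectProperty.isTriangulated_extensionProduct _ _ (le_thickPerp_leftOrthogonal X)

lemma isRightAdmissible_of_isZero {X : C} (hX : IsZero X) : IsRightAdmissible X := by
  rw [IsRightAdmissible, eq_top_iff]
  intro Y _
  refine ObjectProperty.le_extensionProduct_right (P := thick X) _ ?_
  rw [thickPerp_iff]
  exact fun n f => hX.eq_of_src _ _

/-- Decompose `Z` along `X`, then its orthogonal part `B` along `Y`. As `thick Y` is orthogonal to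
`X`, the remainder `B'` stays orthogonal to `X`; reassociating collects both thick parts. -/
lemma IsRightAdmissible.biprod {X Y : C} (hX : IsRightAdmissible X) (hY : IsRightAdmissible Y)
    (h : thickPerp X Y) : IsRightAdmissible (X ⊞ Y) := by
  have hle : thick Y ≤ thickPerp X := thick_le_iff.2 h
  rw [IsRightAdmissible, eq_top_iff]
  intro Z _
  obtain ⟨A, B, a, b, c, hT, hA, hB⟩ : ObjectProperty.extensionProduct _ _ Z :=
    hX.ge Z trivial
  obtain ⟨A', B', a', b', c', hT', hA', hB'⟩ : ObjectProperty.extensionProduct _ _ B :=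
    hY.ge B trivial
  have hB'' : thickPerp X B' :=
    (thickPerp X).ext_of_isTriangulatedClosed₃ _ hT' (hle _ hA') hB
  have h₁ : ObjectProperty.extensionProduct (thick X)
      (ObjectProperty.extensionProduct (thick Y) (thickPerp (X ⊞ Y))) Z :=
    ⟨A, B, a, b, c, hT, hA, A', B', a', b', c', hT', hA', thickPerp_biprod_iff.2 ⟨hB'', hB'⟩⟩
  rw [← ObjectProperty.extensionProduct_assoc] at h₁
  exact ObjectProperty.monotone_extensionProduct_left _
    (ObjectProperty.extensionProduct_le_of_isTriangulatedClosed₂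
      (thick_le_thick_biprod_left X Y) (thick_le_thick_biprod_right X Y)) _ h₁

end Thick

/-! ### Exact Hom sequences of shifted triangles -/

section ShiftHom

variable {C : Type*} [Category* C] [HasShift C ℤ] [Preadditive C]

lemma hom_shift_shift_eq_zero {X Y : C} {a b c : ℤ} (h : a + b = c)
    (hXY : ∀ g : X ⟶ Y⟦c⟧, g = 0) (f : X ⟶ Y⟦a⟧⟦b⟧) : f = 0 := by
  rw [← cancel_mono ((shiftFunctorAdd' C a b c h).inv.app Y), hXY (_ ≫ _), zero_comp]

variable [∀ n : ℤ, (shiftFunctor C n).Additive]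

lemma hom_shift_eq_zero {X Y : C} {a b c : ℤ} (h : c + a = b)
    (hXY : ∀ g : X ⟶ Y⟦c⟧, g = 0) (f : X⟦a⟧ ⟶ Y⟦b⟧) : f = 0 := by
  obtain ⟨g, hg⟩ := (shiftFunctor C a).map_surjective
    (f ≫ (shiftFunctorAdd' C c a b h).hom.app Y)
  rw [← cancel_mono ((shiftFunctorAdd' C c a b h).hom.app Y), ← hg, hXY g, Functor.map_zero,
    zero_comp]

variable [HasZeroObject C] [Pretriangulated C] {X₁ X₂ X₃ : C} {f : X₁ ⟶ X₂} {g : X₂ ⟶ X₃}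
  {δ : X₃ ⟶ X₁⟦(1 : ℤ)⟧}

lemma exists_shift_lift₃ (hT : Triangle.mk f g δ ∈ distTriang C) {W : C} {n m : ℤ} (h : n + 1 = m)
    (hW : ∀ a : W ⟶ X₁⟦m⟧, a = 0) (φ : W ⟶ X₃⟦n⟧) :
    ∃ ψ : W ⟶ X₂⟦n⟧, φ = ψ ≫ g⟦n⟧' := by
  -- Shifting a triangle by `n` multiplies its morphisms by (-1)ⁿ; the sign is then absorbed in `ψ`.
  obtain ⟨ψ, rfl⟩ : ∃ ψ : W ⟶ X₂⟦n⟧, φ = ψ ≫ (n.negOnePow • g⟦n⟧') :=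
    Triangle.coyoneda_exact₃ _ (Triangle.shift_distinguished _ hT n) φ
      (hom_shift_shift_eq_zero h hW _)
  exact ⟨n.negOnePow • ψ, by rw [Linear.units_smul_comp, Linear.comp_units_smul]⟩

lemma exists_shift_lift₂ (hT : Triangle.mk f g δ ∈ distTriang C) {W : C} {n : ℤ}
    (φ : W ⟶ X₂⟦n⟧) (hφ : φ ≫ g⟦n⟧' = 0) :
    ∃ ψ : W ⟶ X₁⟦n⟧, φ = ψ ≫ f⟦n⟧' := by
  have hφ' : φ ≫ (n.negOnePow • g⟦n⟧') = 0 := by rw [Linear.comp_units_smul, hφ, smul_zero]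
  obtain ⟨ψ, rfl⟩ : ∃ ψ : W ⟶ X₁⟦n⟧, φ = ψ ≫ (n.negOnePow • f⟦n⟧') :=
    Triangle.coyoneda_exact₂ _ (Triangle.shift_distinguished _ hT n) φ hφ'
  exact ⟨n.negOnePow • ψ, by rw [Linear.units_smul_comp, Linear.comp_units_smul]⟩

lemma shift_hom₃_eq_zero (hT : Triangle.mk f g δ ∈ distTriang C) {W : C} {n m : ℤ} (h : n + 1 = m)
    (h₁ : ∀ a : W ⟶ X₁⟦m⟧, a = 0) (h₂ : ∀ a : W ⟶ X₂⟦n⟧, a = 0)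
    (φ : W ⟶ X₃⟦n⟧) : φ = 0 := by
  obtain ⟨ψ, rfl⟩ := exists_shift_lift₃ hT h h₁ φ
  rw [h₂ ψ, zero_comp]

lemma exists_desc_of_comp_connecting_eq_zero (hT : Triangle.mk f g δ ∈ distTriang C) {W : C}
    (φ : X₁⟦(1 : ℤ)⟧ ⟶ W) (hφ : δ ≫ φ = 0) : ∃ ψ : X₂⟦(1 : ℤ)⟧ ⟶ W, φ = f⟦(1 : ℤ)⟧' ≫ ψ := by
  obtain ⟨ψ, rfl⟩ : ∃ ψ : X₂⟦(1 : ℤ)⟧ ⟶ W, φ = (-f⟦(1 : ℤ)⟧') ≫ ψ :=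
    Triangle.yoneda_exact₂ _ (rot_of_distTriang _ (rot_of_distTriang _ hT)) φ hφ
  exact ⟨-ψ, by rw [Preadditive.neg_comp, Preadditive.comp_neg]⟩

lemma distinguished_of_iso₂ (hT : Triangle.mk f g δ ∈ distTriang C) {X₂' : C} (e : X₂ ≅ X₂') :
    Triangle.mk (f ≫ e.hom) (e.inv ≫ g) δ ∈ distTriang C := by
  refine isomorphic_distinguished _ hT _
    (Triangle.isoMk _ _ (Iso.refl X₁) e.symm (Iso.refl X₃) ?_ ?_ ?_)
  · change (f ≫ e.hom) ≫ e.inv = 𝟙 _ ≫ f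
    simp
  · change (e.inv ≫ g) ≫ 𝟙 _ = e.inv ≫ g
    simp
  · change δ ≫ (𝟙 X₁)⟦(1 : ℤ)⟧' = 𝟙 _ ≫ δ
    simp

lemma exists_desc_connecting (hT : Triangle.mk f g δ ∈ distTriang C) {W : C}
    (φ : X₃ ⟶ W) (hφ : g ≫ φ = 0) : ∃ ψ : X₁⟦(1 : ℤ)⟧ ⟶ W, φ = δ ≫ ψ :=
  Triangle.yoneda_exact₃ _ hT φ hφ

end ShiftHom

/-! ### Approximation by sums of copies of a stalk -/

section Stalk

attribute [local instance] Abelian.hasFiniteBiproducts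

variable {H : Type*} [Category* H] [Abelian H] {C : Type*} [Category* C] [Preadditive C]

/-- The components of `φ` form a basis of the Hom space, and the coordinates of `g` give the
factorization. -/
lemma exists_approximation (s : H ⥤ C) [s.Additive] (k : Type*) [Field k] [Linear k C] (T : H)
    (Y : C) [Module.Finite k (s.obj T ⟶ Y)] :
    ∃ (m : ℕ) (φ : s.obj (⨁ fun _ : Fin m => T) ⟶ Y),
      ∀ g : s.obj T ⟶ Y, ∃ h : s.obj T ⟶ s.obj (⨁ fun _ : Fin m => T), g = h ≫ φ := by
  let b := Module.finBasis k (s.obj T ⟶ Y)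
  refine ⟨_, ∑ j, s.map (biproduct.π (fun _ => T) j) ≫ b j, fun g =>
    ⟨∑ i, b.repr g i • s.map (biproduct.ι (fun _ => T) i), ?_⟩⟩
  conv_lhs => rw [← b.sum_repr g]
  rw [Preadditive.sum_comp]
  refine Finset.sum_congr rfl (fun i _ => ?_)
  rw [Linear.smul_comp, Preadditive.comp_sum, Finset.sum_eq_single i]
  · rw [← Category.assoc, ← Functor.map_comp, biproduct.ι_π_self, CategoryTheory.Functor.map_id,
      Category.id_comp]
  · intro j _ hj
    rw [← Category.assoc, ← Functor.map_comp, biproduct.ι_π_ne _ hj.symm, Functor.map_zero,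
      zero_comp]
  · simp

lemma biproduct_hom_eq_zero (s : H ⥤ C) [s.Additive] {W : C} (T : H) (m : ℕ)
    (h : ∀ g : s.obj T ⟶ W, g = 0) (f : s.obj (⨁ fun _ : Fin m => T) ⟶ W) : f = 0 := by
  have h₁ : s.map (∑ j : Fin m,
      biproduct.π (fun _ : Fin m => T) j ≫ biproduct.ι (fun _ : Fin m => T) j) ≫ f = 0 := by
    rw [Functor.map_sum, Preadditive.sum_comp]
    refine Finset.sum_eq_zero (fun j _ => ?_)
    rw [Functor.map_comp, Category.assoc, h (_ ≫ f), comp_zero]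
  simpa [biproduct.total] using h₁

variable [HasShift C ℤ]

lemma hom_stalk_shift_zero_eq_zero_iff (s : H ⥤ C) [s.Additive] [s.Full] [s.Faithful] (X Y : H) :
    (∀ f : s.obj X ⟶ (s.obj Y)⟦(0 : ℤ)⟧, f = 0) ↔ ∀ f : X ⟶ Y, f = 0 := by
  constructor
  · intro h f
    apply s.map_injective
    rw [← cancel_mono ((shiftFunctorZero C ℤ).inv.app (s.obj Y)), h (_ ≫ _), Functor.map_zero,
      zero_comp]
  · intro h f
    obtain ⟨g, hg⟩ := s.map_surjective (f ≫ (shiftFunctorZero C ℤ).hom.app (s.obj Y))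
    rw [← cancel_mono ((shiftFunctorZero C ℤ).hom.app (s.obj Y)), ← hg, h g, Functor.map_zero,
      zero_comp]

variable {s : H ⥤ C} [s.Additive]

lemma hom_biproduct_eq_zero [∀ n : ℤ, (shiftFunctor C n).Additive] {W : C} (T : H) (m : ℕ) (n : ℤ)
    (h : ∀ g : W ⟶ (s.obj T)⟦n⟧, g = 0) (f : W ⟶ (s.obj (⨁ fun _ : Fin m => T))⟦n⟧) : f = 0 := by
  have h₁ : f ≫ (s ⋙ shiftFunctor C n).map (∑ j : Fin m,
      biproduct.π (fun _ : Fin m => T) j ≫ biproduct.ι (fun _ : Fin m => T) j) = 0 := by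
    rw [Functor.map_sum, Preadditive.comp_sum]
    refine Finset.sum_eq_zero (fun j _ => ?_)
    rw [Functor.map_comp, ← Category.assoc, h (f ≫ _), zero_comp]
  simpa [biproduct.total] using h₁

variable [HasZeroObject C] [∀ n : ℤ, (shiftFunctor C n).Additive] [Pretriangulated C]

lemma thick_biproduct [IsTriangulated C] (T : H) (m : ℕ) :
    thick (s.obj T) (s.obj (⨁ fun _ : Fin m => T)) := by
  refine (thick (s.obj T)).prop_of_iso (s.mapBiproduct _ ≪≫ biproduct.isoProduct _).symm ?_
  exact ObjectProperty.prop_pi _ _ (fun _ => thick_self _)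

end Stalk

/-! ### Hereditary hearts and orthogonality to a complex -/

section Heart

variable {H : Type*} [Category* H] [Abelian H]
  {C : Type*} [Category* C] [HasZeroObject C] [HasShift C ℤ] [Preadditive C]
  [∀ n : ℤ, (shiftFunctor C n).Additive] [Pretriangulated C]

/-- `HeartSum s b X` says that `X` is a finite direct sum of objects `s(M)[-i]` with `i < b`,
with at most one summand for each `i`. -/
inductive HeartSum (s : H ⥤ C) : ℤ → C → Prop
  | zero (b : ℤ) (X : C) (hX : IsZero X) : HeartSum s b X
  | succ (b : ℤ) (X Y : C) (M : H) (hX : HeartSum s b X) (e : Y ≅ X ⊞ (s.obj M)⟦-b⟧) :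
      HeartSum s (b + 1) Y

/-- A functor `s` from an abelian category to a triangulated category which behaves as the inclusion
of a hereditary abelian category in its bounded derived category. -/
structure IsHereditaryHeart (s : H ⥤ C) : Prop where
  exists_triangle (S : ShortComplex H) (hS : S.ShortExact) :
    ∃ δ : s.obj S.X₃ ⟶ (s.obj S.X₁)⟦(1 : ℤ)⟧,
      Triangle.mk (s.map S.f) (s.map S.g) δ ∈ distTriang C
  hom_eq_zero (X Y : H) (n : ℤ) (hn : n < 0 ∨ 2 ≤ n) (f : s.obj X ⟶ (s.obj Y)⟦n⟧) : f = 0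
  exists_iso {X Z : H} {E : C} (a : s.obj X ⟶ E) (b : E ⟶ s.obj Z)
    (c : s.obj Z ⟶ (s.obj X)⟦(1 : ℤ)⟧) (hT : Triangle.mk a b c ∈ distTriang C) :
    ∃ Y : H, Nonempty (E ≅ s.obj Y)
  exists_heartSum (X : C) : ∃ b, HeartSum s b X

namespace IsHereditaryHeart

variable {s : H ⥤ C} (hs : IsHereditaryHeart s)

include hs

lemma induction {P : C → Prop} (hP : ∀ {X Y : C}, (X ≅ Y) → P X → P Y)
    (hzero : ∀ X, IsZero X → P X)
    (hadd : ∀ X Y : C, P X → P Y → P (X ⊞ Y)) (hstalk : ∀ (M : H) (n : ℤ), P ((s.obj M)⟦n⟧))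
    (X : C) : P X := by
  obtain ⟨b, hX⟩ := hs.exists_heartSum X
  induction hX with
  | zero b X hX => exact hzero X hX
  | succ b X Y M hX e ih => exact hP e.symm (hadd _ _ ih (hstalk M _))

lemma eq_top {P : ObjectProperty C} [P.IsTriangulated] [P.IsClosedUnderIsomorphisms]
    (hP : ∀ M : H, P (s.obj M)) : P = ⊤ := by
  rw [eq_top_iff]
  intro X _
  refine hs.induction (P := P) (fun e h => P.prop_of_iso e h) (fun X hX => P.prop_of_isZero hX)
    (fun X Y hX hY => P.prop_biprod_of_isTriangulated hX hY) (fun M n => P.le_shift n _ (hP M)) X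

/-- A summand `s(M)[-i]` has `i < b`, so it contributes Hom from `s(M)` to `s(N)[m + i]` with `m + i
< 0`. -/
lemma heartSum_hom_eq_zero {b : ℤ} {X : C} (hX : HeartSum s b X) (N : H) (m : ℤ) (hm : m ≤ -b)
    (f : X ⟶ (s.obj N)⟦m⟧) : f = 0 := by
  induction hX with
  | zero b X hX => exact hX.eq_of_src _ _
  | succ b X Y M hX e ih =>
    rw [← cancel_epi e.inv, comp_zero]
    ext
    · simpa using ih (by lia) _
    · simpa using hom_shift_eq_zero (c := m + b) (by lia)
        (hs.hom_eq_zero M N (m + b) (Or.inl (by lia))) _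

lemma exists_triangle_kernel {X I : H} (p : X ⟶ I) [Epi p] :
    ∃ δ : s.obj I ⟶ (s.obj (kernel p))⟦(1 : ℤ)⟧,
      Triangle.mk (s.map (kernel.ι p)) (s.map p) δ ∈ distTriang C :=
  hs.exists_triangle (.mk (kernel.ι p) p (by simp)) { exact := ShortComplex.exact_kernel p }

lemma exists_triangle_cokernel {I Y : H} (i : I ⟶ Y) [Mono i] :
    ∃ δ : s.obj (cokernel i) ⟶ (s.obj I)⟦(1 : ℤ)⟧,
      Triangle.mk (s.map i) (s.map (cokernel.π i)) δ ∈ distTriang C :=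
  hs.exists_triangle (.mk i (cokernel.π i) (by simp)) { exact := ShortComplex.exact_cokernel i }

lemma thickPerp_extension (D : C) {S : ShortComplex H} (hS : S.ShortExact)
    (h₁ : thickPerp D (s.obj S.X₁)) (h₃ : thickPerp D (s.obj S.X₃)) :
    thickPerp D (s.obj S.X₂) := by
  obtain ⟨δ, hT⟩ := hs.exists_triangle S hS
  exact (thickPerp D).ext_of_isTriangulatedClosed₂ _ hT h₁ h₃

section

variable [s.Additive] [s.Full] [s.Faithful]

/-- The image of `p ≫ i` is a direct summand of `X ⊞ Y` when `Ext¹(Y, X) = 0`. -/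
lemma exists_retraction_image {X I Y : H} (p : X ⟶ I) (i : I ⟶ Y) [Epi p] [Mono i]
    (hYX : ∀ f : s.obj Y ⟶ (s.obj X)⟦(1 : ℤ)⟧, f = 0) :
    ∃ (ρ : I ⟶ X) (σ : Y ⟶ I), ρ ≫ p + i ≫ σ = 𝟙 I := by
  obtain ⟨δ, hT⟩ := hs.exists_triangle_cokernel i
  obtain ⟨ε, hT'⟩ := hs.exists_triangle_kernel p
  -- Since Ext²(coker i, ker p) = 0, the class `δ` lifts along `p`.
  obtain ⟨δ', hδ'⟩ := exists_shift_lift₃ hT' (n := 1) (m := 2) (by lia)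
    (hs.hom_eq_zero _ _ 2 (by lia)) δ
  -- The lift dies in Ext¹(Y, X) = 0, so it is `δ` followed by a morphism, which is the shift of
  -- some `ρ`.
  obtain ⟨r, hr⟩ := exists_desc_connecting hT δ' (hYX _)
  obtain ⟨ρ, rfl⟩ := (s ⋙ shiftFunctor C (1 : ℤ)).map_surjective r
  -- Now `𝟙 I - ρ ≫ p` kills `δ`, so it extends along `i`, which produces `σ`.
  have h₀ : δ ≫ (s ⋙ shiftFunctor C (1 : ℤ)).map (𝟙 I - ρ ≫ p) = 0 := by
    rw [Functor.map_sub, Functor.map_comp, CategoryTheory.Functor.map_id, Preadditive.comp_sub,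
      sub_eq_zero, ← Category.assoc, ← hr]
    exact (Category.comp_id δ).trans hδ'
  obtain ⟨q, hq⟩ := exists_desc_of_comp_connecting_eq_zero hT _ h₀
  obtain ⟨σ, rfl⟩ := (s ⋙ shiftFunctor C (1 : ℤ)).map_surjective q
  refine ⟨ρ, σ, (s ⋙ shiftFunctor C (1 : ℤ)).map_injective ?_⟩
  rw [Functor.map_add, (s ⋙ shiftFunctor C (1 : ℤ)).map_comp i, Functor.comp_map _ _ i, ← hq,
    Functor.map_sub]
  abel

section

variable [IsTriangulated C]

lemma thickPerp_stalk_iff (T N : H) : thickPerp (s.obj T) (s.obj N) ↔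
    (∀ f : T ⟶ N, f = 0) ∧ ∀ f : s.obj T ⟶ (s.obj N)⟦(1 : ℤ)⟧, f = 0 := by
  rw [thickPerp_iff, ← hom_stalk_shift_zero_eq_zero_iff s]
  refine ⟨fun h => ⟨h 0, h 1⟩, fun ⟨h₀, h₁⟩ n f => ?_⟩
  obtain hn | rfl | rfl : (n < 0 ∨ 2 ≤ n) ∨ n = 0 ∨ n = 1 := by lia
  · exact hs.hom_eq_zero _ _ n hn f
  · exact h₀ f
  · exact h₁ f

/-- For a stalk object `T`, images of morphisms between objects of the orthogonal of `T` stay in the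
orthogonal of `T`. The same holds for all objects of `C` by dévissage. -/
lemma thickPerp_image (D : C) {M I N : H} (p : M ⟶ I) (i : I ⟶ N) [Epi p] [Mono i]
    (hM : thickPerp D (s.obj M)) (hN : thickPerp D (s.obj N)) : thickPerp D (s.obj I) := by
  revert hM hN
  refine hs.induction (P := fun D => thickPerp D (s.obj M) → thickPerp D (s.obj N) →
    thickPerp D (s.obj I)) ?_ ?_ ?_ ?_ D
  · intro X Y e h
    rwa [thickPerp, ← thick_congr e]
  · intro X hX _ _
    rw [thickPerp_iff]
    exact fun n f => hX.eq_of_src _ _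
  · intro X Y hX hY hM hN
    rw [thickPerp_biprod_iff] at hM hN ⊢
    exact ⟨hX hM.1 hN.1, hY hM.2 hN.2⟩
  · intro T n
    rw [thickPerp, thick_shift]
    change thickPerp _ _ → thickPerp _ _ → thickPerp _ _
    simp only [hs.thickPerp_stalk_iff]
    -- Half of each hypothesis suffices: Hom(T, I) embeds in Hom(T, N), and Ext¹(T, I) is a quotient
    -- of Ext¹(T, M) because Ext² vanishes.
    rintro ⟨-, hM⟩ ⟨hN, -⟩
    obtain ⟨δ, hT⟩ := hs.exists_triangle_kernel p
    refine ⟨fun f => ?_, fun f => ?_⟩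
    · rw [← cancel_mono i, hN (f ≫ i), zero_comp]
    · exact shift_hom₃_eq_zero hT (n := 1) (m := 2) (by lia) (hs.hom_eq_zero _ _ 2 (by lia)) hM f

lemma thickPerp_kernel (D : C) {M N : H} (f : M ⟶ N)
    (hM : thickPerp D (s.obj M)) (hN : thickPerp D (s.obj N)) :
    thickPerp D (s.obj (kernel f)) := by
  obtain ⟨δ, hT⟩ := hs.exists_triangle_kernel (Abelian.factorThruImage f)
  have hI := hs.thickPerp_image D (Abelian.factorThruImage f) (Abelian.image.ι f) hM hN
  have hK := (thickPerp D).ext_of_isTriangulatedClosed₁ _ hT hM hI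
  refine (thickPerp D).prop_of_iso (s.mapIso ?_) hK
  exact (kernelCompMono _ (Abelian.image.ι f)).symm ≪≫ kernelIsoOfEq (Abelian.image.fac f)

lemma thickPerp_cokernel (D : C) {M N : H} (f : M ⟶ N)
    (hM : thickPerp D (s.obj M)) (hN : thickPerp D (s.obj N)) :
    thickPerp D (s.obj (cokernel f)) := by
  obtain ⟨δ, hT⟩ := hs.exists_triangle_cokernel (Abelian.image.ι f)
  have hI := hs.thickPerp_image D (Abelian.factorThruImage f) (Abelian.image.ι f) hM hN
  have hK := (thickPerp D).ext_of_isTriangulatedClosed₃ _ hT hI hN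
  refine (thickPerp D).prop_of_iso (s.mapIso ?_) hK
  exact (cokernelEpiComp (Abelian.factorThruImage f) _).symm ≪≫
    cokernelIsoOfEq (Abelian.image.fac f)

end

end

end IsHereditaryHeart

end Heart

/-! ### Right admissibility for presilting objects -/

section Presilting

attribute [local instance] Abelian.hasFiniteBiproducts

namespace IsHereditaryHeart

variable {H : Type*} [Category* H] [Abelian H]
  {C : Type*} [Category* C] [HasZeroObject C] [HasShift C ℤ] [Preadditive C]
  [∀ n : ℤ, (shiftFunctor C n).Additive] [Pretriangulated C]
  {s : H ⥤ C} (hs : IsHereditaryHeart s) [s.Additive]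
  (k : Type*) [Field k] [Linear k C]

include hs

/-- Take the extension classified by an approximation `φ` of `M[1]`. As Ext¹(T, T) = 0, a class in
Ext¹(T, M') comes from Ext¹(T, M), hence factors through `φ`, which becomes zero in `M'[1]`. -/
lemma exists_universal_extension (T M : H) [Module.Finite k (s.obj T ⟶ (s.obj M)⟦(1 : ℤ)⟧)]
    (hTT : ∀ f : s.obj T ⟶ (s.obj T)⟦(1 : ℤ)⟧, f = 0) :
    ∃ (m : ℕ) (M' : H) (a : s.obj M ⟶ s.obj M') (b : s.obj M' ⟶ s.obj (⨁ fun _ : Fin m => T))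
      (c : s.obj (⨁ fun _ : Fin m => T) ⟶ (s.obj M)⟦(1 : ℤ)⟧),
      Triangle.mk a b c ∈ distTriang C ∧
        ∀ f : s.obj T ⟶ (s.obj M')⟦(1 : ℤ)⟧, f = 0 := by
  obtain ⟨m, φ, hφ⟩ := exists_approximation s k T ((s.obj M)⟦(1 : ℤ)⟧)
  obtain ⟨E, a, b, hE⟩ := distinguished_cocone_triangle₂ φ
  obtain ⟨M', ⟨e⟩⟩ := hs.exists_iso a b φ hE
  have hE' := distinguished_of_iso₂ hE e
  refine ⟨m, M', a ≫ e.hom, e.inv ≫ b, φ, hE', fun f => ?_⟩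
  obtain ⟨g, rfl⟩ := exists_shift_lift₂ hE' (n := 1) f (hom_biproduct_eq_zero T m 1 hTT _)
  obtain ⟨h, rfl⟩ := hφ g
  have h₀ : φ ≫ (a ≫ e.hom)⟦(1 : ℤ)⟧' = 0 := comp_distTriang_mor_zero₃₁ _ hE'
  rw [Category.assoc, h₀, comp_zero]

variable [IsTriangulated C] [s.Full] [s.Faithful]

/-- Factor an approximation of `N` through its image `I`. Since Ext¹(T, I) = 0, maps from `T` to the
cokernel lift to `N`, hence factor through `I` and vanish. Classes in Ext¹(T, ker p) come from maps
`T ⟶ I`, all of which factor through `p`. -/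
lemma exists_stalk_approximation (T N : H) [Module.Finite k (s.obj T ⟶ s.obj N)]
    (hTT : ∀ f : s.obj T ⟶ (s.obj T)⟦(1 : ℤ)⟧, f = 0)
    (hTN : ∀ f : s.obj T ⟶ (s.obj N)⟦(1 : ℤ)⟧, f = 0) :
    ∃ (m : ℕ) (I : H) (p : (⨁ fun _ : Fin m => T) ⟶ I) (i : I ⟶ N) (_ : Epi p) (_ : Mono i),
      thickPerp (s.obj T) (s.obj (cokernel i)) ∧
        ∀ f : s.obj T ⟶ (s.obj (kernel p))⟦(1 : ℤ)⟧, f = 0 := by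
  obtain ⟨m, φ, hφ⟩ := exists_approximation s k T (s.obj N)
  obtain ⟨f, rfl⟩ := s.map_surjective φ
  obtain ⟨I, p, i, _, _, rfl⟩ : ∃ (I : H) (p : _ ⟶ I) (i : I ⟶ N) (_ : Epi p) (_ : Mono i),
      p ≫ i = f :=
    ⟨_, _, _, inferInstance, inferInstance, Abelian.image.fac f⟩
  have hT₀ := hom_biproduct_eq_zero T m 1 hTT
  obtain ⟨δ, hδ⟩ := hs.exists_triangle_cokernel i
  obtain ⟨ε, hε⟩ := hs.exists_triangle_kernel p
  have hTI : ∀ f : s.obj T ⟶ (s.obj I)⟦(1 : ℤ)⟧, f = 0 :=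
    shift_hom₃_eq_zero hε (m := 2) (by lia) (hs.hom_eq_zero _ _ 2 (by lia)) hT₀
  refine ⟨m, _, p, i, inferInstance, inferInstance,
    (hs.thickPerp_stalk_iff _ _).2 ⟨fun g => ?_, ?_⟩, fun g => ?_⟩
  · obtain ⟨g', hg'⟩ : ∃ g' : s.obj T ⟶ s.obj N, s.map g = g' ≫ s.map (cokernel.π i) :=
      Triangle.coyoneda_exact₃ _ hδ (s.map g) (hTI _)
    obtain ⟨h, rfl⟩ := hφ g'
    apply s.map_injective
    rw [hg', Category.assoc, ← s.map_comp, Category.assoc, cokernel.condition, comp_zero,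
      s.map_zero, comp_zero, s.map_zero]
  · exact shift_hom₃_eq_zero hδ (m := 2) (by lia) (hs.hom_eq_zero _ _ 2 (by lia)) hTN
  · obtain ⟨g', rfl⟩ : ∃ g' : s.obj T ⟶ s.obj _, g = g' ≫ ε :=
      Triangle.coyoneda_exact₁ _ hε g (hT₀ _)
    obtain ⟨g', rfl⟩ := s.map_surjective g'
    obtain ⟨h, hh⟩ := hφ (s.map (g' ≫ i))
    obtain ⟨h, rfl⟩ := s.map_surjective h
    obtain rfl : g' = h ≫ p := by
      rw [← cancel_mono i, Category.assoc]
      exact s.map_injective (by rw [hh, s.map_comp h])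
    have h₀ : s.map p ≫ ε = 0 := comp_distTriang_mor_zero₂₃ _ hε
    rw [s.map_comp, Category.assoc, h₀, comp_zero]

/-- Replace `M` by a universal extension `M'`, approximate `M'`, then approximate the kernel `K₀` of
that approximation. Both cokernels are orthogonal to `T`, so only the image `I₁` inside `K₀` has to
be placed in `thick`. -/
lemma prop_stalk_of_rigid (T : H) (hfin : ∀ N : H, Module.Finite k (s.obj T ⟶ s.obj N))
    (hfin' : ∀ N : H, Module.Finite k (s.obj T ⟶ (s.obj N)⟦(1 : ℤ)⟧))
    (hTT : ∀ f : s.obj T ⟶ (s.obj T)⟦(1 : ℤ)⟧, f = 0)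
    (P : ObjectProperty C) [P.IsTriangulated] [P.IsClosedUnderIsomorphisms]
    (hP : thick (s.obj T) ≤ P) (hP' : thickPerp (s.obj T) ≤ P) (M : H) : P (s.obj M) := by
  have hbip (m : ℕ) := hP _ (thick_biproduct (s := s) T m)
  obtain ⟨m, M', a, b, c, hT, hM'⟩ := hs.exists_universal_extension k T M hTT
  suffices hPM' : P (s.obj M') from P.ext_of_isTriangulatedClosed₁ _ hT hPM' (hbip m)
  obtain ⟨m₀, I₀, p₀, i₀, _, _, hC₀, hK₀⟩ := hs.exists_stalk_approximation k T M' hTT hM'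
  obtain ⟨m₁, I₁, p₁, i₁, _, _, hC₁, -⟩ := hs.exists_stalk_approximation k T _ hTT hK₀
  -- `I₁` is the image of a morphism between sums of copies of `T`, hence a summand of the sum of
  -- its source and target by rigidity.
  obtain ⟨ρ, σ, hρσ⟩ := hs.exists_retraction_image p₁ (i₁ ≫ kernel.ι p₀)
    (hom_biproduct_eq_zero T m₁ 1 (biproduct_hom_eq_zero s T m₀ hTT))
  have hI₁ : thick (s.obj T) (s.obj I₁) := by
    refine (thick (s.obj T)).prop_of_retract (Y := s.obj _ ⊞ s.obj _) ?_
      ((thick (s.obj T)).prop_biprod_of_isTriangulated (thick_biproduct T m₁)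
        (thick_biproduct T m₀))
    exact
      { i := biprod.lift (s.map ρ) (s.map (i₁ ≫ kernel.ι p₀))
        r := biprod.desc (s.map p₁) (s.map σ)
        retract := by
          rw [biprod.lift_desc, ← s.map_comp, ← s.map_comp, ← s.map_add, hρσ,
            CategoryTheory.Functor.map_id] }
  obtain ⟨_, h₁⟩ := hs.exists_triangle_cokernel i₁
  obtain ⟨_, h₂⟩ := hs.exists_triangle_kernel p₀
  obtain ⟨_, h₃⟩ := hs.exists_triangle_cokernel i₀
  have hK : P (s.obj (kernel p₀)) :=
    P.ext_of_isTriangulatedClosed₂ _ h₁ (hP _ hI₁) (hP' _ hC₁)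
  have hI : P (s.obj I₀) := P.ext_of_isTriangulatedClosed₃ _ h₂ hK (hbip m₀)
  exact P.ext_of_isTriangulatedClosed₂ _ h₃ hI (hP' _ hC₀)

lemma isRightAdmissible_of_rigid (T : H) (hfin : ∀ N : H, Module.Finite k (s.obj T ⟶ s.obj N))
    (hfin' : ∀ N : H, Module.Finite k (s.obj T ⟶ (s.obj N)⟦(1 : ℤ)⟧))
    (hTT : ∀ f : s.obj T ⟶ (s.obj T)⟦(1 : ℤ)⟧, f = 0) : IsRightAdmissible (s.obj T) := by
  have := isTriangulated_extensionProduct_thick (s.obj T)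
  exact hs.eq_top (hs.prop_stalk_of_rigid k T hfin hfin' hTT _
    (ObjectProperty.le_extensionProduct_left _) (ObjectProperty.le_extensionProduct_right _))

end IsHereditaryHeart

section

variable {C : Type*} [Category* C] [HasShift C ℤ] [Preadditive C]

lemma IsPresilting.hom_eq_zero {X Y Z : C} (hZ : IsPresilting Z) (r : Retract X Z)
    (r' : Retract Y Z) {n : ℤ} (hn : 0 < n) (f : X ⟶ Y⟦n⟧) : f = 0 := by
  have h : f = r.i ≫ (r.r ≫ f ≫ r'.i⟦n⟧') ≫ r'.r⟦n⟧' := by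
    simp [← Functor.map_comp]
  rw [h, hZ n hn (r.r ≫ f ≫ r'.i⟦n⟧'), zero_comp, comp_zero]

lemma IsPresilting.of_retract {X Y : C} (hY : IsPresilting Y) (r : Retract X Y) :
    IsPresilting X :=
  fun _ hn f => hY.hom_eq_zero r r hn f

lemma IsPresilting.of_shift [∀ n : ℤ, (shiftFunctor C n).Additive] {X : C} {m : ℤ}
    (hX : IsPresilting (X⟦m⟧)) : IsPresilting X := by
  intro n hn f
  have h := hX n hn (f⟦m⟧' ≫ (shiftFunctorComm C n m).hom.app X)
  rw [Preadditive.IsIso.comp_right_eq_zero] at h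
  exact (Functor.map_eq_zero_iff _).1 h

end

namespace IsHereditaryHeart

variable {H : Type*} [Category* H] [Abelian H]
  {C : Type*} [Category* C] [HasZeroObject C] [HasShift C ℤ] [Preadditive C]
  [∀ n : ℤ, (shiftFunctor C n).Additive] [Pretriangulated C] [IsTriangulated C]
  {s : H ⥤ C} (hs : IsHereditaryHeart s) [s.Additive] [s.Full] [s.Faithful]
  (k : Type*) [Field k] [Linear k C]

include hs

/-- Induction splits off the summand `s(M)[-b]` of largest `b`. Morphisms from the rest `X` to its
shifts by `n` vanish by presilting for `n > 0` and by degree for `n ≤ 0`, so the gluing lemma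
applies. -/
theorem isRightAdmissible_of_isPresilting
    (hfin : ∀ M N : H, Module.Finite k (s.obj M ⟶ s.obj N))
    (hfin' : ∀ M N : H, Module.Finite k (s.obj M ⟶ (s.obj N)⟦(1 : ℤ)⟧))
    (D : C) (hD : IsPresilting D) : IsRightAdmissible D := by
  obtain ⟨b, hb⟩ := hs.exists_heartSum D
  induction hb with
  | zero b X hX => exact isRightAdmissible_of_isZero hX
  | succ b X Y M hX e ih =>
    have hXM := hD.of_retract e.symm.retract
    have hM := (hXM.of_retract (BinaryBiproduct.bicone X ((s.obj M)⟦-b⟧)).retract_right).of_shift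
    refine IsRightAdmissible.of_thick_eq (thick_congr e.symm) (IsRightAdmissible.biprod
      (ih (hXM.of_retract (BinaryBiproduct.bicone X ((s.obj M)⟦-b⟧)).retract_left))
      (IsRightAdmissible.of_thick_eq (thick_shift _ _).symm
        (hs.isRightAdmissible_of_rigid k M (hfin M) (hfin' M) (hM 1 (by lia)))) ?_)
    rw [thickPerp_iff]
    intro n f
    by_cases hn : 0 < n
    · exact hXM.hom_eq_zero (BinaryBiproduct.bicone X ((s.obj M)⟦-b⟧)).retract_left
        (BinaryBiproduct.bicone X ((s.obj M)⟦-b⟧)).retract_right hn f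
    · exact hom_shift_shift_eq_zero rfl
        (fun g => hs.heartSum_hom_eq_zero hX M (-b + n) (by lia) g) f

/-- A triangulated subcategory is everything as soon as it contains `thick D` and the
objects of the heart which are orthogonal to a presilting object `D`. -/
theorem eq_top_of_isPresilting
    (hfin : ∀ M N : H, Module.Finite k (s.obj M ⟶ s.obj N))
    (hfin' : ∀ M N : H, Module.Finite k (s.obj M ⟶ (s.obj N)⟦(1 : ℤ)⟧))
    (D : C) (hD : IsPresilting D) (P : ObjectProperty C) [P.IsTriangulated]
    [P.IsClosedUnderIsomorphisms] (hP : thick D ≤ P)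
    (hP' : ∀ M : H, thickPerp D (s.obj M) → P (s.obj M)) : P = ⊤ := by
  -- The orthogonal is closed under summands and shifts, so the stalk summands of its objects are
  -- again orthogonal to `D`.
  have hperp : thickPerp D ≤ P := by
    intro X
    refine hs.induction (P := fun X => thickPerp D X → P X) ?_ ?_ ?_ ?_ X
    · exact fun e h h' => P.prop_of_iso e (h ((thickPerp D).prop_of_iso e.symm h'))
    · exact fun X hX _ => P.prop_of_isZero hX
    · intro X Y hX hY h
      exact P.prop_biprod_of_isTriangulated
        (hX (ObjectProperty.IsStableUnderRetracts.of_biprod_left _ h))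
        (hY (ObjectProperty.IsStableUnderRetracts.of_biprod_right _ h))
    · exact fun M n h => P.le_shift n _ (hP' M ((thickPerp_shift_iff n).1 h))
  rw [eq_top_iff, ← hs.isRightAdmissible_of_isPresilting k hfin hfin' D hD]
  exact ObjectProperty.extensionProduct_le_of_isTriangulatedClosed₂ hP hperp

end IsHereditaryHeart

end Presilting

/-! ### Effaceability of Ext and dimension shifting -/

section Effaceable

open Abelian

variable {A : Type u} [Category.{v} A] [Abelian A]

open DerivedCategory HomologicalComplex

lemma single_hom_ext {X : A} {m : ℤ} {L : CochainComplex A ℤ} {f g : (single A (.up ℤ) m).obj X ⟶ L}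
    (h : f.f m = g.f m) : f = g := by
  refine hom_ext _ _ (fun i => ?_)
  by_cases hi : i = m
  · subst hi
    exact h
  · exact (isZero_single_obj_X _ _ _ _ hi).eq_of_src _ _

/-- Write `f` as a left fraction through a complex `L` in nonnegative degrees and take `Z = L⁰`. The
numerator vanishes in degree 0 because `m ≠ 0`; `Y ⟶ L⁰` is mono because the denominator is a
quasi-isomorphism. -/
lemma DerivedCategory.exists_mono_comp_eq_zero [HasDerivedCategory.{w} A] {X Y : A} {m : ℤ}
    (hm : m ≠ 0) (f : (singleFunctor A m).obj X ⟶ (singleFunctor A 0).obj Y) :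
    ∃ (Z : A) (i : Y ⟶ Z) (_ : Mono i), f ≫ (singleFunctor A 0).map i = 0 := by
  let φ : Q.obj ((single A (.up ℤ) m).obj X) ⟶ Q.obj ((single A (.up ℤ) 0).obj Y) :=
    (singleFunctorIsoCompQ A m).inv.app X ≫ f ≫ (singleFunctorIsoCompQ A 0).hom.app Y
  obtain ⟨L, _, g, s, _, hφ⟩ := left_fac_of_isStrictlyGE φ 0
  let r : L ⟶ (single A (.up ℤ) 0).obj (L.X 0) := mkHomToSingle (𝟙 _) (fun i hi =>
    (L.isZero_of_isStrictlyGE 0 i (by simp at hi; lia)).eq_of_src _ _)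
  obtain ⟨i, hi⟩ := (single A (.up ℤ) 0).map_surjective (s ≫ r)
  have hgr : g ≫ r = 0 := single_hom_ext ((isZero_single_obj_X _ _ _ _ hm).eq_of_tgt _ _)
  have hr : IsIso (r.f 0) := by
    simp only [r, mkHomToSingle_f]
    infer_instance
  refine ⟨_, i, Preadditive.mono_of_cancel_zero _ (fun {W} a ha => ?_), ?_⟩
  · have h₁ : (single A (.up ℤ) 0).map a ≫ s = 0 := by
      apply single_hom_ext
      rw [← cancel_mono (r.f 0), ← comp_f, Category.assoc, ← hi, ← Functor.map_comp, ha]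
      simp
    have h₂ : Q.map ((CochainComplex.singleFunctor A 0).map a) = 0 := by
      change Q.map ((single A (.up ℤ) 0).map a) = 0
      rw [← cancel_mono (Q.map s), ← Functor.map_comp, h₁, Functor.map_zero, zero_comp]
    apply (singleFunctor A 0).map_injective
    rw [← cancel_mono ((singleFunctorIsoCompQ A 0).hom.app Y), NatTrans.naturality,
      Functor.comp_map, h₂, Limits.comp_zero, Functor.map_zero, zero_comp]
  · rw [← cancel_epi ((singleFunctorIsoCompQ A m).inv.app X),
      ← cancel_mono ((singleFunctorIsoCompQ A 0).hom.app _), Category.assoc, Category.assoc,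
      NatTrans.naturality, Functor.comp_map, Limits.comp_zero, zero_comp]
    have : φ ≫ Q.map ((CochainComplex.singleFunctor A 0).map i) = 0 := by
      change φ ≫ Q.map ((single A (.up ℤ) 0).map i) = 0
      rw [hi, hφ, Functor.map_comp, Category.assoc, IsIso.inv_hom_id_assoc, ← Functor.map_comp, hgr,
        Functor.map_zero]
    refine Eq.trans ?_ this
    simp only [φ]
    exact (Category.assoc _ _ _).symm.trans ((Category.assoc _ _ _).symm.trans
      (congrArg (· ≫ _) (Category.assoc _ _ _)))

/-- Every element of `Ext` in positive degree is killed by a monomorphism in the second variable. -/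
lemma CategoryTheory.Abelian.Ext.exists_mono_comp_eq_zero [HasExt.{w} A] {X Y : A} {n : ℕ}
    (hn : n ≠ 0) (x : Ext X Y n) :
    ∃ (Z : A) (i : Y ⟶ Z) (_ : Mono i), x.comp (mk₀ i) (add_zero _) = 0 := by
  let := HasDerivedCategory.standard A
  obtain ⟨f, hf⟩ := (shiftFunctor (DerivedCategory A) (n : ℤ)).map_surjective
    (((singleFunctors A).shiftIso (n : ℤ) 0 (n : ℤ) (by simp)).hom.app X ≫ x.hom)
  obtain ⟨Z, i, hi, h⟩ := DerivedCategory.exists_mono_comp_eq_zero (by simpa using hn) f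
  refine ⟨Z, i, hi, ?_⟩
  ext
  rw [comp_hom, mk₀_hom, ShiftedHom.comp_mk₀, zero_hom,
    ← cancel_epi (((singleFunctors A).shiftIso (n : ℤ) 0 (n : ℤ) (by simp)).hom.app X),
    ← Category.assoc, ← hf, ← Functor.map_comp, h, Functor.map_zero, Limits.comp_zero]



/-- Dimension shifting: a class killed by a monomorphism comes from its cokernel, one degree lower.
-/
lemma CategoryTheory.Abelian.Ext.exists_shortExact_comp_extClass [HasExt.{w} A] {X Y : A} {n m : ℕ}
    (h : n + 1 = m) (x : Ext X Y m) :
    ∃ (Z Q : A) (i : Y ⟶ Z) (q : Z ⟶ Q) (hi : i ≫ q = 0) (hS : (ShortComplex.mk i q hi).ShortExact)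
      (y : Ext X Q n), y.comp hS.extClass h = x := by
  obtain ⟨Z, i, _, hx⟩ := x.exists_mono_comp_eq_zero (by lia)
  have hS : (ShortComplex.mk i (cokernel.π i) (cokernel.condition i)).ShortExact :=
    { exact := ShortComplex.exact_cokernel i }
  exact ⟨_, _, i, cokernel.π i, _, hS, covariant_sequence_exact₁ _ hS x hx h⟩

/-- Every element of `Ext¹` is the class of an extension. -/
lemma CategoryTheory.Abelian.Ext.exists_extClass_eq [HasExt.{w} A] {X Y : A} (x : Ext X Y 1) :
    ∃ (E : A) (i : Y ⟶ E) (p : E ⟶ X) (hi : i ≫ p = 0) (hS : (ShortComplex.mk i p hi).ShortExact),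
      hS.extClass = x := by
  obtain ⟨Z, Q, i, q, hi, hS, y, rfl⟩ := x.exists_shortExact_comp_extClass (zero_add 1)
  -- Shifting down to degree 0 gives a morphism `f`; the wanted extension is the pullback of the
  -- sequence along `f`.
  obtain ⟨f, rfl⟩ := (mk₀_bijective X Q).2 y
  have : Mono i := hS.mono_f
  have : Epi q := hS.epi_g
  have hi' : i ≫ q = 0 ≫ f := by rw [hi, Limits.zero_comp]
  have hw : pullback.lift i 0 hi' ≫ pullback.snd q f = 0 := pullback.lift_snd _ _ _
  have : Mono (pullback.lift i 0 hi') := mono_of_mono_fac (pullback.lift_fst i 0 hi')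
  have hS' : (ShortComplex.mk (pullback.lift i 0 hi') (pullback.snd q f) hw).ShortExact :=
    ShortComplex.ShortExact.mk (ShortComplex.exact_of_f_is_kernel _
      (KernelFork.IsLimit.ofι' _ _ (fun {W} g hg => by
        have hg' : (g ≫ pullback.fst q f) ≫ q = 0 := by
          rw [Category.assoc, pullback.condition, reassoc_of% hg, Limits.zero_comp]
        refine ⟨hS.exact.lift _ hg', pullback.hom_ext ?_ ?_⟩
        · refine (Category.assoc _ _ _).trans ?_
          rw [pullback.lift_fst]
          exact hS.exact.lift_f _ _
        · refine (Category.assoc _ _ _).trans ?_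
          rw [pullback.lift_snd, Limits.comp_zero]
          exact hg.symm)))
  refine ⟨_, _, _, hw, hS', ?_⟩
  have := ShortComplex.ShortExact.extClass_naturality hS' hS
    { τ₁ := 𝟙 Y, τ₂ := pullback.fst q f, τ₃ := f,
      comm₁₂ := (Category.id_comp i).trans (pullback.lift_fst i 0 hi').symm
      comm₂₃ := pullback.condition }
  exact (Ext.comp_mk₀_id _).symm.trans this

lemma CategoryTheory.ShortComplex.ShortExact.exists_retraction_of_extClass_eq_zero [HasExt.{w} A]
    {X Y Z : A} {i : X ⟶ Y} {p : Y ⟶ Z} {hi : i ≫ p = 0}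
    (hS : (ShortComplex.mk i p hi).ShortExact) (h : hS.extClass = 0) :
    ∃ r : Y ⟶ X, i ≫ r = 𝟙 X := by
  obtain ⟨r, hr⟩ : ∃ r : Ext Y X 0, (Ext.mk₀ i).comp r (zero_add 0) = Ext.mk₀ (𝟙 X) :=
    Ext.contravariant_sequence_exact₁ hS _ (Ext.mk₀ (𝟙 X)) (add_zero 1)
      ((congrArg (fun x : Ext Z X 1 => x.comp (Ext.mk₀ (𝟙 X)) (add_zero 1)) h).trans (by simp))
  obtain ⟨r, rfl⟩ := (Ext.mk₀_bijective _ _).2 r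
  rw [Ext.mk₀_comp_mk₀] at hr
  exact ⟨r, (Ext.mk₀_bijective _ _).1 hr⟩

lemma CategoryTheory.Abelian.Ext.eq_zero_of_two_le [HasExt.{w} A]
    (h : ∀ X Y : A, Subsingleton (Ext X Y 2)) {X Y : A} {n : ℕ} (hn : 2 ≤ n) (x : Ext X Y n) :
    x = 0 := by
  induction n, hn using Nat.le_induction generalizing Y with
  | base => exact Subsingleton.elim _ _
  | succ n hn ih =>
    obtain ⟨Z, Q, i, q, hi, hS, y, rfl⟩ := x.exists_shortExact_comp_extClass rfl
    rw [ih y, zero_comp]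

end Effaceable

/-! ### Ext under fully faithful exact functors -/

section FullyFaithfulExact

open Abelian

variable {A : Type*} [Category* A] [Abelian A] {B : Type*} [Category* B] [Abelian B]
  (F : A ⥤ B) [F.Additive] [PreservesFiniteLimits F] [PreservesFiniteColimits F]
  [F.Full] [F.Faithful] [HasExt.{w} A] [HasExt.{w'} B]

/-- If the image of an extension splits, fullness and faithfulness bring the retraction back. -/
lemma CategoryTheory.Functor.mapExtAddHom_one_injective (X Y : A) :
    Function.Injective (F.mapExtAddHom X Y 1) := by
  rw [injective_iff_map_eq_zero]
  intro x hx
  obtain ⟨E, i, p, hi, hS, rfl⟩ := x.exists_extClass_eq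
  rw [mapExtAddHom_apply, Ext.mapExactFunctor_extClass] at hx
  have hS' : (ShortComplex.mk (F.map i) (F.map p)
    (by rw [← F.map_comp, hi, F.map_zero])).ShortExact := hS.map_of_exact F
  obtain ⟨r, hr⟩ := hS'.exists_retraction_of_extClass_eq_zero hx
  obtain ⟨r, rfl⟩ := F.map_surjective r
  have hir : i ≫ r = 𝟙 Y := F.map_injective (by simpa using hr)
  have : hS.extClass.comp ((Ext.mk₀ i).comp (Ext.mk₀ r) (zero_add 0)) (add_zero 1) = 0 :=
    hS.extClass_comp_assoc (Ext.mk₀ r)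
  rw [Ext.mk₀_comp_mk₀, hir] at this
  exact (Ext.comp_mk₀_id _).symm.trans this

/-- Extension closure puts the middle term in the essential image; fullness lifts the maps and
faithfulness reflects exactness. -/
lemma CategoryTheory.Functor.mapExtAddHom_one_surjective
    (hF : ∀ S : ShortComplex B, S.ShortExact → F.essImage S.X₁ → F.essImage S.X₃ →
      F.essImage S.X₂) (X Y : A) :
    Function.Surjective (F.mapExtAddHom X Y 1) := by
  intro y
  obtain ⟨E, i, p, hi, hS, rfl⟩ := y.exists_extClass_eq
  obtain ⟨E', ⟨e⟩⟩ := hF _ hS (F.obj_mem_essImage Y) (F.obj_mem_essImage X)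
  dsimp at e
  obtain ⟨i', hi'⟩ := F.map_surjective (i ≫ e.inv)
  obtain ⟨p', hp'⟩ := F.map_surjective (e.hom ≫ p)
  have hw : i' ≫ p' = 0 := F.map_injective (by simp [hi', hp', hi])
  have hw' : F.map i' ≫ F.map p' = 0 := by rw [← F.map_comp, hw, F.map_zero]
  let α : ShortComplex.mk (F.map i') (F.map p') hw' ≅ ShortComplex.mk i p hi :=
    ShortComplex.isoMk (Iso.refl _) e (Iso.refl _) (by simp [hi']) (by simp [hp'])
  have hS₁ : (ShortComplex.mk (F.map i') (F.map p') hw').ShortExact :=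
    ShortComplex.shortExact_of_iso α.symm hS
  have : Mono i' := F.mono_of_mono_map hS₁.mono_f
  have : Epi p' := F.epi_of_epi_map hS₁.epi_g
  have hS' : (ShortComplex.mk i' p' hw).ShortExact :=
    { exact := (ShortComplex.exact_map_iff_of_faithful _ F).1 hS₁.exact }
  refine ⟨hS'.extClass, ?_⟩
  rw [mapExtAddHom_apply, Ext.mapExactFunctor_extClass]
  have := ShortComplex.ShortExact.extClass_naturality hS₁ hS α.hom
  exact (Ext.comp_mk₀_id _).symm.trans (this.trans (Ext.mk₀_id_comp _))

/-- Write `x` as `y` in Ext¹(X, Q) times a connecting class. As Ext² vanishes in `B`, the image of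
`y` lifts along `F(q)`; bijectivity on Ext¹ then lifts `y` along `q`, and `q` kills the connecting
class. -/
lemma CategoryTheory.Functor.subsingleton_ext_two_of_exact
    (hF : ∀ S : ShortComplex B, S.ShortExact → F.essImage S.X₁ → F.essImage S.X₃ →
      F.essImage S.X₂) (hB : ∀ X Y : B, Subsingleton (Ext X Y 2)) (X Y : A) :
    Subsingleton (Ext X Y 2) := by
  refine subsingleton_of_forall_eq 0 (fun x => ?_)
  obtain ⟨Z, Q, i, q, hi, hS, y, rfl⟩ := x.exists_shortExact_comp_extClass (n := 1) rfl
  obtain ⟨z, hz⟩ := Ext.covariant_sequence_exact₃ _ (hS.map_of_exact F) (y.mapExactFunctor F)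
    (n₁ := 2) rfl (Subsingleton.elim _ _)
  obtain ⟨z, rfl⟩ := F.mapExtAddHom_one_surjective hF X Z z
  obtain rfl : z.comp (Ext.mk₀ q) (add_zero 1) = y := by
    apply F.mapExtAddHom_one_injective
    rw [mapExtAddHom_apply, Ext.mapExactFunctor_comp, Ext.mapExactFunctor_mk₀]
    exact hz
  rw [Ext.comp_assoc_of_second_deg_zero]
  exact (congrArg (z.comp · _) hS.comp_extClass).trans (Ext.comp_zero _ _ _ _ _)

end FullyFaithfulExact

/-! ### Morphisms into sums of shifted stalks -/

section HomHeartSum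

variable {H : Type*} [Category* H]
  {C : Type*} [Category* C] [HasZeroObject C] [HasShift C ℤ] [Preadditive C]
  [∀ n : ℤ, (shiftFunctor C n).Additive] [Pretriangulated C]

/-- A summand `s(M)[-i]` of `X` contributes degree `1 - i - m`, which is at least 2 since `i < b`
and `m ≤ -b`. -/
lemma HeartSum.hom_shift_eq_zero {s : H ⥤ C}
    (hs : ∀ (X Y : H) (n : ℤ), 2 ≤ n → ∀ f : s.obj X ⟶ (s.obj Y)⟦n⟧, f = 0)
    {b : ℤ} {X : C} (hX : HeartSum s b X) (N : H) (m : ℤ) (hm : m ≤ -b)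
    (f : (s.obj N)⟦m⟧ ⟶ X⟦(1 : ℤ)⟧) : f = 0 := by
  induction hX with
  | zero b X hX => exact ((shiftFunctor C (1 : ℤ)).map_isZero hX).eq_of_tgt _ _
  | succ b X Y M hX e ih =>
    have h₁ : f ≫ (e.hom ≫ biprod.fst)⟦(1 : ℤ)⟧' = 0 := ih (by lia) _
    have h₂ : f ≫ (e.hom ≫ biprod.snd)⟦(1 : ℤ)⟧' = 0 := by
      rw [← cancel_mono ((shiftFunctorAdd' C (-b) 1 (-b + 1) rfl).inv.app (s.obj M)), zero_comp]
      exact _root_.hom_shift_eq_zero (c := -b + 1 - m) (by lia) (hs N M _ (by lia)) _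
    have h : 𝟙 Y = (e.hom ≫ biprod.fst) ≫ biprod.inl ≫ e.inv +
        (e.hom ≫ biprod.snd) ≫ biprod.inr ≫ e.inv := by
      simp only [Category.assoc, ← Preadditive.comp_add]
      rw [← Category.assoc biprod.fst, ← Category.assoc biprod.snd, ← Preadditive.add_comp,
        biprod.total, Category.id_comp, e.hom_inv_id]
    rw [← Category.comp_id f, ← CategoryTheory.Functor.map_id, h, Functor.map_add,
      Functor.map_comp _ (_ ≫ biprod.fst), Functor.map_comp _ (_ ≫ biprod.snd),
      Preadditive.comp_add, ← Category.assoc, h₁, ← Category.assoc, h₂, zero_comp, zero_comp,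
      add_zero]

end HomHeartSum

/-! ### The standard heart of the bounded derived category -/

section BoundedStalk

open DerivedCategory DerivedCategory.TStructure

variable {H : Type u} [Category.{v} H] [Abelian H] [HasDerivedCategory.{w} H]

variable (H) in
/-- The inclusion of an abelian category in its bounded derived category, as complexes concentrated
in degree `0`. -/
noncomputable def boundedStalkFunctor : H ⥤ Bounded H :=
  t.bounded.lift (singleFunctor H 0) (fun M => (boundedStalk M).property)

variable (H) in
/-- The stalk functor, followed by the inclusion in the unbounded derived category. -/
noncomputable def boundedStalkFunctorCompι :
    boundedStalkFunctor H ⋙ Bounded.ι ≅ singleFunctor H 0 :=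
  t.bounded.liftCompιIso _ _

instance : (boundedStalkFunctor H).Full :=
  Functor.Full.of_comp_faithful_iso (boundedStalkFunctorCompι H)

instance : (boundedStalkFunctor H).Faithful :=
  Functor.Faithful.of_comp_iso (boundedStalkFunctorCompι H)

instance : (boundedStalkFunctor H).Additive where
  map_add {X Y f g} := Bounded.ι.map_injective (by
    change (singleFunctor H 0).map (f + g) = (singleFunctor H 0).map f + (singleFunctor H 0).map g
    rw [Functor.map_add])

/-- Morphisms to a shift in the bounded derived category, computed in the derived category. -/
noncomputable def DerivedCategory.Bounded.homShiftAddEquiv (X Y : Bounded H) (n : ℤ) :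
    (X ⟶ Y⟦n⟧) ≃+ (X.obj ⟶ Y.obj⟦n⟧) :=
  AddEquiv.mk' (t.bounded.fullyFaithfulι.homEquiv.trans
    ((Bounded.ι.commShiftIso n).app Y).homToEquiv) (fun f g => by
      change Bounded.ι.map (f + g) ≫ _ = Bounded.ι.map f ≫ _ + Bounded.ι.map g ≫ _
      rw [Functor.map_add, Preadditive.add_comp])

lemma boundedStalk_hom_eq_zero_of_neg (X Y : H) {n : ℤ} (hn : n < 0)
    (f : boundedStalk X ⟶ (boundedStalk Y)⟦n⟧) : f = 0 := by
  apply (Bounded.homShiftAddEquiv _ _ n).injective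
  have : t.IsLE (boundedStalk X).obj 0 := inferInstanceAs (t.IsLE ((singleFunctor H 0).obj X) 0)
  have : t.IsGE (boundedStalk Y).obj 0 := inferInstanceAs (t.IsGE ((singleFunctor H 0).obj Y) 0)
  have : t.IsGE ((boundedStalk Y).obj⟦n⟧) (-n) := t.isGE_shift _ 0 n (-n)
  rw [map_zero]
  exact t.zero _ 0 (-n) (by lia)

lemma boundedStalk_hom_eq_zero_of_two_le [HasExt.{w'} H]
    (h : ∀ X Y : H, Subsingleton (Abelian.Ext X Y 2)) (X Y : H) {n : ℤ} (hn : 2 ≤ n)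
    (f : boundedStalk X ⟶ (boundedStalk Y)⟦n⟧) : f = 0 := by
  apply (Bounded.homShiftAddEquiv _ _ n).injective
  obtain ⟨n, rfl⟩ := Int.eq_ofNat_of_zero_le (show 0 ≤ n by lia)
  obtain ⟨x, hx⟩ := (Abelian.Ext.homEquiv (X := X) (Y := Y) (n := n)).surjective
    (Bounded.homShiftAddEquiv _ _ (n : ℤ) f)
  rw [map_zero, ← hx, x.eq_zero_of_two_le h (by lia)]
  exact Abelian.Ext.zero_hom _ _ _

lemma boundedStalk_exists_triangle {S : ShortComplex H} (hS : S.ShortExact) :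
    ∃ δ : (boundedStalkFunctor H).obj S.X₃ ⟶ ((boundedStalkFunctor H).obj S.X₁)⟦(1 : ℤ)⟧,
      Triangle.mk ((boundedStalkFunctor H).map S.f) ((boundedStalkFunctor H).map S.g) δ ∈
        distTriang (Bounded H) := by
  refine ⟨(Bounded.homShiftAddEquiv _ _ 1).symm hS.singleδ, ?_⟩
  change Bounded.ι.mapTriangle.obj _ ∈ distTriang (DerivedCategory H)
  refine isomorphic_distinguished _ hS.singleTriangle_distinguished _ ?_
  refine Triangle.isoMk _ _ (Iso.refl _) (Iso.refl _) (Iso.refl _) ?_ ?_ ?_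
  · exact (Category.comp_id _).trans (Category.id_comp _).symm
  · exact (Category.comp_id _).trans (Category.id_comp _).symm
  · refine Eq.trans ?_ (Category.id_comp _).symm
    refine Eq.trans ?_ ((Bounded.homShiftAddEquiv ((boundedStalkFunctor H).obj S.X₃)
      ((boundedStalkFunctor H).obj S.X₁) 1).apply_symm_apply hS.singleδ)
    exact (congrArg (_ ≫ ·) (CategoryTheory.Functor.map_id _ _)).trans (Category.comp_id _)

lemma exists_iso_boundedStalk (X : Bounded H) (n : ℤ) [X.obj.IsGE n] [X.obj.IsLE n] :
    ∃ M : H, Nonempty (X ≅ (boundedStalk M)⟦-n⟧) := by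
  obtain ⟨M, ⟨e⟩⟩ := exists_iso_singleFunctor_obj_of_isGE_of_isLE X.obj n
  refine ⟨M, ⟨t.bounded.fullyFaithfulι.preimageIso (e ≪≫ ?_)⟩⟩
  exact ((singleFunctors H).shiftIso (-n) n 0 (by lia)).symm.app M ≪≫
    ((Bounded.ι.commShiftIso (-n)).app (boundedStalk M)).symm

lemma boundedStalk_exists_iso {X Z : H} {E : Bounded H} (a : boundedStalk X ⟶ E)
    (b : E ⟶ boundedStalk Z) (c : boundedStalk Z ⟶ (boundedStalk X)⟦(1 : ℤ)⟧)
    (hT : Triangle.mk a b c ∈ distTriang (Bounded H)) :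
    ∃ Y : H, Nonempty (E ≅ boundedStalk Y) := by
  have h₁ : t.IsLE E.obj 0 := t.isLE₂ _ hT 0
    (inferInstanceAs (t.IsLE ((singleFunctor H 0).obj X) 0))
    (inferInstanceAs (t.IsLE ((singleFunctor H 0).obj Z) 0))
  have h₂ : t.IsGE E.obj 0 := t.isGE₂ _ hT 0
    (inferInstanceAs (t.IsGE ((singleFunctor H 0).obj X) 0))
    (inferInstanceAs (t.IsGE ((singleFunctor H 0).obj Z) 0))
  obtain ⟨Y, ⟨e⟩⟩ := exists_iso_singleFunctor_obj_of_isGE_of_isLE E.obj 0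
  exact ⟨Y, ⟨t.bounded.fullyFaithfulι.preimageIso e⟩⟩

/-- Induction on the number `n` of allowed degrees: the truncation splitting off the top degree has
a connecting morphism made of Ext in degrees at least 2, so its triangle splits. -/
lemma heartSum_boundedStalkFunctor [HasExt.{w'} H]
    (h : ∀ X Y : H, Subsingleton (Abelian.Ext X Y 2)) (a : ℤ) (n : ℕ) (X : Bounded H)
    [t.onBounded.IsGE X a] [t.onBounded.IsLE X (a + n - 1)] :
    HeartSum (boundedStalkFunctor H) (a + n) X := by
  induction n generalizing X with
  | zero => exact .zero _ _ (t.onBounded.isZero X (a + (0 : ℕ) - 1) a (by lia))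
  | succ n ih =>
    let Y := (t.onBounded.truncLT (a + n)).obj X
    let Z := (t.onBounded.truncGE (a + n)).obj X
    let δ : Z ⟶ Y⟦(1 : ℤ)⟧ := (t.onBounded.truncGEδLT (a + n)).app X
    have hX' : t.onBounded.IsLE X (a + n) := t.onBounded.isLE_of_le X (a + (n + 1 : ℕ) - 1) (a + n)
    have hY : HeartSum (boundedStalkFunctor H) (a + n) Y := ih Y
    have hZ : Z.obj.IsGE (a + n) := (t.bounded.tStructure_isGE_iff t Z _).1
      (inferInstanceAs (t.onBounded.IsGE ((t.onBounded.truncGE (a + n)).obj X) (a + n)))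
    have hZ' : Z.obj.IsLE (a + n) := (t.bounded.tStructure_isLE_iff t Z _).1
      (inferInstanceAs (t.onBounded.IsLE ((t.onBounded.truncGE (a + n)).obj X) (a + n)))
    obtain ⟨M, ⟨e⟩⟩ := exists_iso_boundedStalk Z (a + n)
    have hδ : δ = 0 := by
      rw [← cancel_epi e.inv, comp_zero]
      exact hY.hom_shift_eq_zero
        (fun X Y n hn f => boundedStalk_hom_eq_zero_of_two_le h X Y hn f) M _ le_rfl _
    obtain ⟨e', -⟩ := exists_iso_binaryBiproduct_of_distTriang _
      (t.onBounded.triangleLTGE_distinguished (a + n) X) hδ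
    have := HeartSum.succ (a + n) Y X M hY (e' ≪≫ biprod.mapIso (Iso.refl Y) e)
    rwa [add_assoc] at this

/-- The stalk complexes in the bounded derived category of a hereditary abelian category. -/
theorem isHereditaryHeart_boundedStalkFunctor [HasExt.{w'} H]
    (h : ∀ X Y : H, Subsingleton (Abelian.Ext X Y 2)) :
    IsHereditaryHeart (boundedStalkFunctor H) where
  exists_triangle S hS := boundedStalk_exists_triangle hS
  hom_eq_zero X Y n hn f := hn.elim (fun hn => boundedStalk_hom_eq_zero_of_neg X Y hn f)
    (fun hn => boundedStalk_hom_eq_zero_of_two_le h X Y hn f)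
  exists_iso a b c hT := boundedStalk_exists_iso a b c hT
  exists_heartSum X := by
    obtain ⟨⟨a, ha⟩, ⟨b, hb⟩⟩ := X.property
    have := (t.bounded.tStructure_isGE_iff t X a).2 ha
    have := (t.bounded.tStructure_isLE_iff t X b).2 hb
    -- If `b < a`, `toNat` returns 0 and the bound `a - 1` still dominates `b`.
    have := t.onBounded.isLE_of_le X b (a + (b - a + 1).toNat - 1)
    exact ⟨_, heartSum_boundedStalkFunctor h a (b - a + 1).toNat X⟩

end BoundedStalk

/-! ### Finiteness of Hom and Ext between stalks -/

section Finiteness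

open DerivedCategory DerivedCategory.TStructure

variable (k : Type t) [Field k] {H : Type u} [Category.{v} H] [Abelian H] [Linear k H]
  [HasDerivedCategory.{w} H]

instance : (boundedStalkFunctor H).Linear k where
  map_smul {X Y} f r := Bounded.ι.map_injective (by
    change (singleFunctor H 0).map (r • f) = r • (singleFunctor H 0).map f
    rw [Functor.map_smul])

/-- Morphisms to a shift in the bounded derived category, computed in the derived category. -/
noncomputable def DerivedCategory.Bounded.homShiftLinearEquiv (X Y : Bounded H) (n : ℤ) :
    (X ⟶ Y⟦n⟧) ≃ₗ[k] (X.obj ⟶ Y.obj⟦n⟧) :=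
  { homShiftAddEquiv X Y n with
    map_smul' := fun r f => by
      change Bounded.ι.map (r • f) ≫ _ = r • Bounded.ι.map f ≫ _
      rw [Functor.map_smul, Linear.smul_comp] }

variable {k}

namespace IsHereditaryAbelian

variable (hH : IsHereditaryAbelian k H)

include hH

lemma finite_boundedStalk_hom (M N : H) :
    Module.Finite k ((boundedStalkFunctor H).obj M ⟶ (boundedStalkFunctor H).obj N) := by
  have := hH.hom_finite M N
  exact Module.Finite.of_surjective ((boundedStalkFunctor H).mapLinearMap k)
    (boundedStalkFunctor H).map_surjective

lemma finite_boundedStalk_hom_shift (M N : H) :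
    Module.Finite k ((boundedStalkFunctor H).obj M ⟶
      ((boundedStalkFunctor H).obj N)⟦(1 : ℤ)⟧) := by
  have := HasExt.standard H
  have := hH.ext_finite M N
  exact Module.Finite.equiv ((Abelian.Ext.homLinearEquiv (R := k) (X := M) (Y := N) (n := 1)).trans
    (Bounded.homShiftLinearEquiv k ((boundedStalkFunctor H).obj M)
      ((boundedStalkFunctor H).obj N) 1).symm)

lemma isHereditaryHeart : IsHereditaryHeart (boundedStalkFunctor H) :=
  have := HasExt.standard H
  isHereditaryHeart_boundedStalkFunctor hH.ext_two

end IsHereditaryAbelian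

end Finiteness

lemma CategoryTheory.ObjectProperty.essImage_ι_of_shortExact {H : Type u}
    [Category.{v} H] [Abelian H] (P : ObjectProperty H) [P.IsClosedUnderIsomorphisms]
    (hP : ∀ S : ShortComplex H, S.ShortExact → P S.X₁ → P S.X₃ → P S.X₂)
    (S : ShortComplex H) (hS : S.ShortExact) (h₁ : P.ι.essImage S.X₁) (h₃ : P.ι.essImage S.X₃) :
    P.ι.essImage S.X₂ := by
  obtain ⟨X, ⟨e⟩⟩ := h₁
  obtain ⟨Z, ⟨e'⟩⟩ := h₃
  exact ⟨⟨S.X₂, hP S hS (P.prop_of_iso e X.property) (P.prop_of_iso e' Z.property)⟩, ⟨Iso.refl _⟩⟩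

/-! ### Hereditary full subcategories -/

section AbelianSubcategory

variable {H : Type u} [Category.{v} H] [Abelian H] (P : ObjectProperty H) [P.ContainsZero]
  [P.IsClosedUnderFiniteProducts] [P.IsClosedUnderKernels] [P.IsClosedUnderCokernels]

instance : PreservesFiniteLimits P.ι := by
  have := P.preservesKernels_ι
  exact P.ι.preservesFiniteLimits_of_preservesKernels

instance : PreservesFiniteColimits P.ι := by
  have := P.preservesCokernels_ι
  exact P.ι.preservesFiniteColimits_of_preservesCokernels

/-- A full subcategory of a hereditary abelian category which is closed under finite products,
kernels, cokernels and extensions is hereditary. -/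
lemma IsHereditaryAbelian.fullSubcategory {k : Type t} [Field k] [Linear k H]
    (hH : IsHereditaryAbelian k H) [P.IsClosedUnderIsomorphisms]
    (hP : ∀ S : ShortComplex H, S.ShortExact → P S.X₁ → P S.X₃ → P S.X₂) :
    IsHereditaryAbelian k P.FullSubcategory := by
  have := HasExt.standard H
  have := HasExt.standard P.FullSubcategory
  refine ⟨fun X Y => ?_, fun X Y => ?_, fun X Y => ?_⟩
  · have : Module.Finite k (P.ι.obj X ⟶ P.ι.obj Y) := hH.hom_finite X.obj Y.obj
    exact Module.Finite.of_injective (P.ι.mapLinearMap k) P.ι.map_injective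
  · have : Module.Finite k (Abelian.Ext (P.ι.obj X) (P.ι.obj Y) 1) := hH.ext_finite X.obj Y.obj
    exact Module.Finite.of_injective (P.ι.mapExtLinearMap k X Y 1)
      (P.ι.mapExtAddHom_one_injective X Y)
  · exact P.ι.subsingleton_ext_two_of_exact (P.essImage_ι_of_shortExact hP) hH.ext_two X Y

end AbelianSubcategory

/-! ### Closure properties of the perpendicular category -/

section Perp

open DerivedCategory DerivedCategory.TStructure

variable {k : Type t} [Field k] {H : Type u} [Category.{v} H] [Abelian H] [Linear k H]
  [HasDerivedCategory.{w} H] (D : Bounded H)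

lemma perpZ_iff {M : H} : perpZ D M ↔ thickPerp D ((boundedStalkFunctor H).obj M) :=
  thickPerp_iff.symm

instance : (perpZ D).IsClosedUnderIsomorphisms where
  of_iso e h := by
    rw [perpZ_iff] at h ⊢
    exact (thickPerp D).prop_of_iso ((boundedStalkFunctor H).mapIso e) h

instance : (perpZ D).IsClosedUnderFiniteProducts where
  isClosedUnderLimitsOfShape J _ := ⟨by
    rintro X ⟨p⟩
    rw [perpZ_iff]
    exact (thickPerp D).prop_of_isLimit (isLimitOfPreserves (boundedStalkFunctor H) p.isLimit)
      (fun j => (perpZ_iff D).1 (p.prop_diag_obj j))⟩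

instance : (perpZ D).ContainsZero where
  exists_zero := ⟨_, isZero_zero H, (perpZ_iff D).2
    ((thickPerp D).prop_of_isZero ((boundedStalkFunctor H).map_isZero (isZero_zero H)))⟩

variable {D} (hH : IsHereditaryAbelian k H)

include hH

lemma IsHereditaryAbelian.perpZ_isClosedUnderKernels : (perpZ D).IsClosedUnderKernels where
  kernels_le := by
    rintro _ ⟨f, c, hc, hf₁, hf₂⟩
    refine (perpZ D).prop_of_iso ((limit.isLimit _).conePointUniqueUpToIso hc) ?_
    rw [perpZ_iff] at *
    exact hH.isHereditaryHeart.thickPerp_kernel D f hf₁ hf₂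

lemma IsHereditaryAbelian.perpZ_isClosedUnderCokernels : (perpZ D).IsClosedUnderCokernels where
  cokernels_le := by
    rintro _ ⟨f, c, hc, hf₁, hf₂⟩
    refine (perpZ D).prop_of_iso ((colimit.isColimit _).coconePointUniqueUpToIso hc) ?_
    rw [perpZ_iff] at *
    exact hH.isHereditaryHeart.thickPerp_cokernel D f hf₁ hf₂

lemma IsHereditaryAbelian.perpZ_of_shortExact (S : ShortComplex H) (hS : S.ShortExact)
    (h₁ : perpZ D S.X₁) (h₃ : perpZ D S.X₃) : perpZ D S.X₂ := by
  rw [perpZ_iff] at *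
  exact hH.isHereditaryHeart.thickPerp_extension D hS h₁ h₃

end Perp

/-! ### Full faithfulness by dévissage -/

section MapBijective

variable {C : Type*} [Category* C] {C' : Type*} [Category* C']

/-- `MapBijective G X Y` says that `G` induces a bijection on morphisms from `X` to `Y`. -/
def MapBijective (G : C ⥤ C') (X Y : C) : Prop :=
  Function.Bijective (G.map : (X ⟶ Y) → (G.obj X ⟶ G.obj Y))

variable {G : C ⥤ C'}

namespace MapBijective

lemma of_iso {X X' Y Y' : C} (h : MapBijective G X Y) (e : X ≅ X') (e' : Y ≅ Y') :
    MapBijective G X' Y' := by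
  have : (G.map : (X' ⟶ Y') → _) = ((G.mapIso e).homCongr (G.mapIso e')) ∘ G.map ∘
      (e.homCongr e').symm := by
    ext f
    simp [← Functor.map_comp]
  rw [MapBijective, this]
  exact (Equiv.bijective _).comp (h.comp (Equiv.bijective _))

section Shift

variable [HasShift C ℤ] [HasShift C' ℤ] [G.CommShift ℤ]

lemma shift {X Y : C} (h : MapBijective G X Y) (n : ℤ) :
    MapBijective G (X⟦n⟧) (Y⟦n⟧) := by
  have : (G.map : (X⟦n⟧ ⟶ Y⟦n⟧) → _) ∘ (shiftFunctor C n).map =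
      (((G.commShiftIso n).app X).symm.homCongr ((G.commShiftIso n).app Y).symm) ∘
        (shiftFunctor C' n).map ∘ G.map := by
    ext f
    simp
  have h' : Function.Bijective ((shiftFunctor C n).map : (X ⟶ Y) → _) :=
    Functor.FullyFaithful.map_bijective (.ofFullyFaithful _) X Y
  rw [MapBijective, ← Function.Bijective.of_comp_iff _ h', this]
  exact (Equiv.bijective _).comp
    ((Functor.FullyFaithful.map_bijective (.ofFullyFaithful _) _ _).comp h)

lemma shift_shift {X Y : C} {a b c : ℤ} (hc : c + a = b)
    (h : MapBijective G X (Y⟦c⟧)) : MapBijective G (X⟦a⟧) (Y⟦b⟧) :=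
  (h.shift a).of_iso (Iso.refl _) ((shiftFunctorAdd' C c a b hc).app Y).symm

end Shift

variable [Preadditive C] [Preadditive C'] [G.Additive]

lemma of_isZero_left {X : C} (hX : IsZero X) (Y : C) : MapBijective G X Y :=
  ⟨fun _ _ _ => hX.eq_of_src _ _, fun _ => ⟨0, (G.map_isZero hX).eq_of_src _ _⟩⟩

lemma of_isZero_right (X : C) {Y : C} (hY : IsZero Y) : MapBijective G X Y :=
  ⟨fun _ _ _ => hY.eq_of_tgt _ _, fun _ => ⟨0, (G.map_isZero hY).eq_of_tgt _ _⟩⟩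

variable [HasBinaryBiproducts C]

lemma biprod_left {X X' Y : C} (h : MapBijective G X Y) (h' : MapBijective G X' Y) :
    MapBijective G (X ⊞ X') Y := by
  refine ⟨fun f g hfg => ?_, fun f => ?_⟩
  · ext
    · exact h.1 (by rw [G.map_comp, hfg, G.map_comp])
    · exact h'.1 (by rw [G.map_comp, hfg, G.map_comp])
  · obtain ⟨a, ha⟩ := h.2 (G.map biprod.inl ≫ f)
    obtain ⟨b, hb⟩ := h'.2 (G.map biprod.inr ≫ f)
    refine ⟨biprod.fst ≫ a + biprod.snd ≫ b, ?_⟩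
    rw [G.map_add, G.map_comp, G.map_comp, ha, hb, ← Category.assoc, ← Category.assoc,
      ← Preadditive.add_comp, ← G.map_comp, ← G.map_comp, ← G.map_add, biprod.total]
    simp

lemma biprod_right {X Y Y' : C} (h : MapBijective G X Y) (h' : MapBijective G X Y') :
    MapBijective G X (Y ⊞ Y') := by
  refine ⟨fun f g hfg => ?_, fun f => ?_⟩
  · ext
    · exact h.1 (by rw [G.map_comp, hfg, G.map_comp])
    · exact h'.1 (by rw [G.map_comp, hfg, G.map_comp])
  · obtain ⟨a, ha⟩ := h.2 (f ≫ G.map biprod.fst)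
    obtain ⟨b, hb⟩ := h'.2 (f ≫ G.map biprod.snd)
    refine ⟨a ≫ biprod.inl + b ≫ biprod.inr, ?_⟩
    rw [G.map_add, G.map_comp, G.map_comp, ha, hb, Category.assoc, Category.assoc,
      ← Preadditive.comp_add, ← G.map_comp, ← G.map_comp, ← G.map_add, biprod.total]
    simp

end MapBijective

/-- A functor which commutes with the shifts is fully faithful on the category spanned by a
hereditary abelian category when it is so on morphisms between shifts of stalks. -/
lemma IsHereditaryHeart.mapBijective {H : Type*} [Category* H] [Abelian H] [HasZeroObject C]
    [Preadditive C] [HasShift C ℤ] [∀ n : ℤ, (shiftFunctor C n).Additive] [Pretriangulated C]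
    {s : H ⥤ C} (hs : IsHereditaryHeart s) [Preadditive C'] [HasShift C' ℤ] [G.CommShift ℤ] [G.Additive]
    (hG : ∀ (M N : H) (n : ℤ), MapBijective G (s.obj M) ((s.obj N)⟦n⟧)) (X Y : C) :
    MapBijective G X Y := by
  refine hs.induction (P := fun X => MapBijective G X Y) (fun e h => h.of_iso e (Iso.refl _))
    (fun X hX => .of_isZero_left hX Y) (fun X X' h h' => h.biprod_left h') (fun M a => ?_) X
  refine hs.induction (P := fun Y => MapBijective G ((s.obj M)⟦a⟧) Y)
    (fun e h => h.of_iso (Iso.refl _) e) (fun Y hY => .of_isZero_right _ hY)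
    (fun Y Y' h h' => h.biprod_right h') (fun N b => ?_) Y
  exact (hG M N (b - a)).shift_shift (by lia)

end MapBijective

/-! ### Exact functors on bounded derived categories -/

section ExactFunctor

open DerivedCategory DerivedCategory.TStructure

variable {A : Type*} [Category* A] [Abelian A] [HasDerivedCategory.{w} A]
  {B : Type*} [Category* B] [Abelian B] [HasDerivedCategory.{w'} B]
  (F : A ⥤ B) [F.Additive] [PreservesFiniteLimits F] [PreservesFiniteColimits F]

lemma CategoryTheory.Functor.mapDerivedCategory_isLE (X : DerivedCategory A) (n : ℤ) [X.IsLE n] :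
    (F.mapDerivedCategory.obj X).IsLE n := by
  obtain ⟨K, _, ⟨e⟩⟩ := X.exists_iso_Q_obj_of_isLE n
  have : t.IsLE ((F.mapHomologicalComplex (.up ℤ) ⋙ Q).obj K) n :=
    inferInstanceAs ((Q.obj ((F.mapHomologicalComplex (.up ℤ)).obj K)).IsLE n)
  exact t.isLE_of_iso (F.mapDerivedCategory.mapIso e ≪≫ F.mapDerivedCategoryFactors.app K).symm n

lemma CategoryTheory.Functor.mapDerivedCategory_isGE (X : DerivedCategory A) (n : ℤ) [X.IsGE n] :
    (F.mapDerivedCategory.obj X).IsGE n := by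
  obtain ⟨K, _, ⟨e⟩⟩ := X.exists_iso_Q_obj_of_isGE n
  have : t.IsGE ((F.mapHomologicalComplex (.up ℤ) ⋙ Q).obj K) n :=
    inferInstanceAs ((Q.obj ((F.mapHomologicalComplex (.up ℤ)).obj K)).IsGE n)
  exact t.isGE_of_iso (F.mapDerivedCategory.mapIso e ≪≫ F.mapDerivedCategoryFactors.app K).symm n

/-- The functor between bounded derived categories induced by an exact functor. -/
noncomputable def CategoryTheory.Functor.mapBounded : Bounded A ⥤ Bounded B :=
  t.bounded.lift (Bounded.ι ⋙ F.mapDerivedCategory) (by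
    rintro ⟨X, ⟨⟨a, _⟩, ⟨b, _⟩⟩⟩
    exact ⟨⟨a, F.mapDerivedCategory_isGE X a⟩, ⟨b, F.mapDerivedCategory_isLE X b⟩⟩)

noncomputable instance : F.mapBounded.CommShift ℤ :=
  inferInstanceAs ((t.bounded.lift _ _).CommShift ℤ)

instance : F.mapBounded.IsTriangulated :=
  inferInstanceAs (t.bounded.lift _ _).IsTriangulated

instance (k : Type*) [Ring k] [Linear k A] [Linear k B] [F.Linear k] : F.mapBounded.Linear k where
  map_smul f r := Bounded.ι.map_injective
    ((Bounded.ι ⋙ F.mapDerivedCategory).map_smul r f)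

/-- The functor induced on bounded derived categories extends the given functor. -/
noncomputable def CategoryTheory.Functor.boundedStalkFunctorCompMapBounded :
    boundedStalkFunctor A ⋙ F.mapBounded ≅ F ⋙ boundedStalkFunctor B :=
  Functor.FullyFaithful.whiskeringRight t.bounded.fullyFaithfulι A |>.preimageIso
    (F.mapDerivedCategorySingleFunctor 0)

lemma CategoryTheory.Functor.mapBijective_mapDerivedCategory_of_ext [HasExt.{t} A] [HasExt.{u} B]
    (M N : A) (n : ℕ) (h : Function.Bijective (F.mapExtAddHom M N n)) :
    MapBijective F.mapDerivedCategory ((singleFunctor A 0).obj M)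
      (((singleFunctor A 0).obj N)⟦(n : ℤ)⟧) := by
  let e := ((F.mapDerivedCategorySingleFunctor 0).app M).homCongr
    ((F.mapDerivedCategory.commShiftIso (n : ℤ)).app ((singleFunctor A 0).obj N) ≪≫
      (shiftFunctor _ (n : ℤ)).mapIso ((F.mapDerivedCategorySingleFunctor 0).app N))
  have he : e ∘ F.mapDerivedCategory.map ∘ Abelian.Ext.homEquiv (X := M) (Y := N) (n := n) =
      Abelian.Ext.homEquiv ∘ F.mapExtAddHom M N n := by
    ext x
    refine Eq.trans ?_ (x.mapExactFunctor_hom F).symm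
    simp [e, ShiftedHom.map, Abelian.Ext.hom]
  rw [MapBijective, ← Function.Bijective.of_comp_iff _ (Equiv.bijective Abelian.Ext.homEquiv),
    ← Function.Bijective.of_comp_iff' e.bijective, he]
  exact (Equiv.bijective _).comp h

/-- The functor between bounded derived categories induced by the exact inclusion of an
extension closed subcategory in a hereditary abelian category is fully faithful. -/
lemma CategoryTheory.Functor.mapBijective_mapBounded [F.Full] [F.Faithful] [HasExt.{t} A]
    [HasExt.{u} B]
    (hF : ∀ S : ShortComplex B, S.ShortExact → F.essImage S.X₁ → F.essImage S.X₃ →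
      F.essImage S.X₂) (hB : ∀ X Y : B, Subsingleton (Abelian.Ext X Y 2)) (X Y : Bounded A) :
    MapBijective F.mapBounded X Y := by
  have hA : ∀ X Y : A, Subsingleton (Abelian.Ext X Y 2) := F.subsingleton_ext_two_of_exact hF hB
  suffices h : MapBijective (Bounded.ι ⋙ F.mapDerivedCategory) X Y by
    have h' : MapBijective (F.mapBounded ⋙ Bounded.ι) X Y := h
    exact (Function.Bijective.of_comp_iff' (t.bounded.fullyFaithfulι.map_bijective _ _)
      F.mapBounded.map).1 h'
  refine (isHereditaryHeart_boundedStalkFunctor hA).mapBijective (fun M N n => ?_) X Y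
  suffices h : MapBijective F.mapDerivedCategory ((singleFunctor A 0).obj M)
      (((singleFunctor A 0).obj N)⟦n⟧) from
    (h.of_iso (Iso.refl _) ((Bounded.ι.commShiftIso n).app (boundedStalk N)).symm).comp
      (t.bounded.fullyFaithfulι.map_bijective _ _)
  obtain ⟨n, rfl⟩ | hn : (∃ m : ℕ, n = m) ∨ n < 0 := by
    by_cases h : n < 0
    · exact Or.inr h
    · exact Or.inl (Int.eq_ofNat_of_zero_le (by lia))
  · apply F.mapBijective_mapDerivedCategory_of_ext
    -- Degree 0 is full faithfulness of `F`, degree 1 is extension closure, and from degree 2 on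
    -- both sides are zero.
    obtain rfl | rfl | hn : n = 0 ∨ n = 1 ∨ 2 ≤ n := by lia
    · rw [mapExtAddHom_coe, Abelian.Ext.mapExactFunctor₀]
      exact (Equiv.bijective _).comp
        ((Functor.FullyFaithful.map_bijective (.ofFullyFaithful F) _ _).comp (Equiv.bijective _))
    · exact ⟨F.mapExtAddHom_one_injective M N, F.mapExtAddHom_one_surjective hF M N⟩
    · exact ⟨fun x y _ => (x.eq_zero_of_two_le hA hn).trans (y.eq_zero_of_two_le hA hn).symm,
        fun y => ⟨0, (map_zero _).trans (y.eq_zero_of_two_le hB hn).symm⟩⟩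
  · have : t.IsGE (((singleFunctor A 0).obj N)⟦n⟧) (-n) := t.isGE_shift _ 0 n (-n)
    have := F.mapDerivedCategory_isGE (((singleFunctor A 0).obj N)⟦n⟧) (-n)
    have := F.mapDerivedCategory_isLE ((singleFunctor A 0).obj M) 0
    exact ⟨fun _ _ _ => (t.zero _ 0 (-n) (by lia)).trans (t.zero _ 0 (-n) (by lia)).symm,
      fun _ => ⟨0, (F.mapDerivedCategory.map_zero _ _).trans (t.zero _ 0 (-n) (by lia)).symm⟩⟩

end ExactFunctor

/-! ### The Verdier quotient -/

open ZeroObject in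
lemma CategoryTheory.ObjectProperty.isZero_obj_of_isLocalization_trW {C : Type*} [Category* C]
    [HasZeroObject C] [HasShift C ℤ] [Preadditive C] [∀ n : ℤ, (shiftFunctor C n).Additive]
    [Pretriangulated C] {E : Type*} [Category* E] [Preadditive E] (P : ObjectProperty C)
    (L : C ⥤ E) [L.IsLocalization P.trW] [L.Additive] {X : C} (hX : P X) : IsZero (L.obj X) := by
  have h : P.trW (0 : 0 ⟶ X) := ObjectProperty.trW.mk P (contractible_distinguished₁ X) hX
  have := Localization.inverts L P.trW _ h
  exact (L.map_isZero (isZero_zero C)).of_iso (asIso (L.map (0 : 0 ⟶ X))).symm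

theorem proposition2p12 (k : Type t) [Field k] (H : Type u) [Category.{v} H] [Abelian H]
    [Linear k H] (hH : IsHereditaryAbelian k H) [HasDerivedCategory.{w} H]
    (D : DerivedCategory.Bounded H) (hD : IsPresilting D) :
    ∃ (_ : (perpZ D).ContainsZero) (_ : (perpZ D).IsClosedUnderFiniteProducts)
      (_ : (perpZ D).IsClosedUnderKernels) (_ : (perpZ D).IsClosedUnderCokernels),
      IsHereditaryAbelian k (perpZ D).FullSubcategory ∧
      ∀ [HasDerivedCategory.{w'} (perpZ D).FullSubcategory],
        ∃ (F : DerivedCategory.Bounded (perpZ D).FullSubcategory ⥤ VerdierQuotient D)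
          (_ : F.CommShift ℤ), F.IsTriangulated ∧ F.IsEquivalence ∧ F.Linear k := by
  have := hH.perpZ_isClosedUnderKernels (D := D)
  have := hH.perpZ_isClosedUnderCokernels (D := D)
  have hP := hH.fullSubcategory (perpZ D) hH.perpZ_of_shortExact
  refine ⟨inferInstance, inferInstance, inferInstance, inferInstance, hP, ?_⟩
  intro _
  have := HasExt.standard H
  have := HasExt.standard (perpZ D).FullSubcategory
  let Φ := (perpZ D).ι.mapBounded
  let L : DerivedCategory.Bounded H ⥤ VerdierQuotient D := (thick D).trW.Q
  -- The orthogonal is triangulated, so it suffices to test `Φ` on stalks.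
  have hΦ : (thickPerp D).inverseImage Φ = ⊤ := hP.isHereditaryHeart.eq_top (fun M =>
    (thickPerp D).prop_of_iso ((perpZ D).ι.boundedStalkFunctorCompMapBounded.app M).symm
      ((perpZ_iff D).1 M.property))
  have hΦ' (Y : DerivedCategory.Bounded (perpZ D).FullSubcategory) : thickPerp D (Φ.obj Y) := by
    have : (thickPerp D).inverseImage Φ Y := by rw [hΦ]; trivial
    exact this
  -- `L` is bijective on morphisms whose target is right orthogonal to `thick D`.
  have hbij (X Y : DerivedCategory.Bounded (perpZ D).FullSubcategory) : MapBijective (Φ ⋙ L) X Y :=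
    ((hΦ' Y).map_bijective_of_isTriangulated L _).comp
      ((perpZ D).ι.mapBijective_mapBounded ((perpZ D).essImage_ι_of_shortExact
        hH.perpZ_of_shortExact) hH.ext_two X Y)
  have hfull : (Φ ⋙ L).Full := ⟨fun {X Y} => (hbij X Y).2⟩
  have hfaithful : (Φ ⋙ L).Faithful := ⟨fun {X Y} => (hbij X Y).1⟩
  have hess : (Φ ⋙ L).essImage.IsTriangulated := inferInstance
  -- This preimage is triangulated; it contains `thick D`, which `L` sends to zero, and the stalks
  -- of `perpZ D`, so admissibility makes it everything.
  have htop : (Φ ⋙ L).essImage.inverseImage L = ⊤ := by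
    refine hH.isHereditaryHeart.eq_top_of_isPresilting k hH.finite_boundedStalk_hom
      hH.finite_boundedStalk_hom_shift D hD _ ?_ ?_
    · exact fun X hX =>
        (Φ ⋙ L).essImage.prop_of_isZero ((thick D).isZero_obj_of_isLocalization_trW L hX)
    · intro M hM
      exact ⟨(boundedStalkFunctor _).obj ⟨M, (perpZ_iff D).2 hM⟩,
        ⟨L.mapIso ((perpZ D).ι.boundedStalkFunctorCompMapBounded.app ⟨M, (perpZ_iff D).2 hM⟩)⟩⟩
  have hess : (Φ ⋙ L).EssSurj := ⟨fun Y => by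
    have : (Φ ⋙ L).essImage.inverseImage L (L.objPreimage Y) := by rw [htop]; trivial
    exact (Φ ⋙ L).essImage.prop_of_iso (L.objObjPreimageIso Y) this⟩
  exact ⟨Φ ⋙ L, inferInstance, inferInstance, { }, inferInstance⟩
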